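/- Let $Q$ be a domain (a non-empty connected open set, not necessarily bounded or convex) in the hyperbolic plane $\mathbb{H}^2$ of curvature $-1$, whose boundary is piecewise smooth: $\partial Q$ is a locally finite union of compact $C^\infty$ arcs, each simple except that its two ends may coincide, which meet one another at most at their ends, and the arcs are oriented so that near its interior points each arc has $Q$ on its left and not on its right. A boundary point is regular if all arcs through it have the same unit tangent vector there. Let $s$ be arclength along $\partial Q$ and let $\varphi\in[0,\pi]$ be the angle, measured counterclockwise, from the boundary tangent to the outgoing ray. The billiard map $T$ sends a pair $(s,\varphi)$ at a regular boundary point to the pair $(s',\varphi')$, where $s'$ is the point at which the geodesic leaving the point $s$ at angle $\varphi$, after running inside $Q$, first hits $\partial Q$, provided that this point exists and is regular, and $\varphi'$ is the angle of the ray reflected there by the law "angle of incidence equals angle of reflection". Then the set of 3-periodic points of the billiard, $$\{x\in\partial Q\times[0,\pi] : T^3x \text{ is defined and } T^3x=x\},$$ has measure zero with respect to the measure $\sin\varphi\,d\varphi\,ds$ on $\partial Q\times[0,\pi]$. -/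

import Mathlib

open Set Filter Topology MeasureTheory
open scoped UpperHalfPlane ContDiff

noncomputable section

/-- A billiard on the hyperbolic plane `ℍ` (upper half-plane with its metric of curvature `-1`):
a domain, not necessarily bounded or convex, with piecewise smooth boundary.  The boundary is a
locally finite (hence countable) union of compact smooth arcs `arc i : [0, len i] → ℍ`,
parametrized by arclength, simple except that the two ends of an arc may coincide, meeting each
other at most at their ends, and such that the domain lies locally on the left of each arc. -/
structure HyperbolicBilliard where
  /-- The domain (open and connected). -/
  domain : Set ℍ
  isOpen_domain : IsOpen domain
  isConnected_domain : IsConnected domain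
  /-- The index set of the boundary arcs. -/
  ι : Type
  /-- The length of an arc. -/
  len : ι → ℝ
  len_pos : ∀ i, 0 < len i
  /-- The arcs; only the values on `[0, len i]` matter. -/
  arc : ι → ℝ → ℍ
  /-- Each arc is smooth up to its ends. -/
  smooth : ∀ i, ContDiffOn ℝ ∞ (fun s => (arc i s : ℂ)) (Icc 0 (len i))
  /-- Unit speed for the metric `|dz| / Im z`. -/
  unit_speed : ∀ i, ∀ s ∈ Icc 0 (len i),
    ‖derivWithin (fun u => (arc i u : ℂ)) (Icc 0 (len i)) s‖ = (arc i s).im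
  injOn_left : ∀ i, InjOn (arc i) (Ico 0 (len i))
  injOn_right : ∀ i, InjOn (arc i) (Ioc 0 (len i))
  meet_at_ends : ∀ i j, i ≠ j → ∀ s ∈ Icc 0 (len i), ∀ t ∈ Icc 0 (len j),
    arc i s = arc j t → (s = 0 ∨ s = len i) ∧ (t = 0 ∨ t = len j)
  locallyFinite_arcs : LocallyFinite fun i => arc i '' Icc 0 (len i)
  frontier_eq : frontier domain = ⋃ i, arc i '' Icc 0 (len i)
  /-- Points slightly to the left of an arc lie in the domain, those slightly to the right
  do not. -/
  left_side : ∀ i, ∀ s ∈ Ioo 0 (len i), ∀ᶠ ε : ℝ in 𝓝[>] 0, ∀ z : ℍ,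
    ((z : ℂ) = arc i s +
        ε * (Complex.I * derivWithin (fun u => (arc i u : ℂ)) (Icc 0 (len i)) s) →
      z ∈ domain) ∧
    ((z : ℂ) = arc i s -
        ε * (Complex.I * derivWithin (fun u => (arc i u : ℂ)) (Icc 0 (len i)) s) →
      z ∉ domain)

namespace HyperbolicBilliard

variable (B : HyperbolicBilliard)

/-- The unit tangent vectors at `p` of the boundary arcs through `p` (one-sided at ends). -/
def tangents (p : ℍ) : Set ℂ :=
  {v | ∃ i, ∃ s ∈ Icc 0 (B.len i), B.arc i s = p ∧
    v = derivWithin (fun u => (B.arc i u : ℂ)) (Icc 0 (B.len i)) s}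

/-- `τ` is the unit tangent vector of the boundary at its point `p`, and `p` is not a corner:
all arcs through `p` have the tangent vector `τ` there. -/
def HasTangent (p : ℍ) (τ : ℂ) : Prop := B.tangents p = {τ}

/-- The graph of the billiard ball map `T` on pairs `(p, φ)`, where `p` is a boundary point and
`φ ∈ [0, π]` is the counterclockwise angle from the boundary tangent to the outgoing ray.
`B.Step x y` says `T x = y`: the unit speed geodesic `γ` (a distance-preserving map `ℝ → ℍ`)
that leaves `x.1` at the angle `x.2` runs inside the domain until it hits the boundary at
`y.1`, which is not a corner, and there the reflected ray leaves at the angle `y.2`: angle of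
incidence equals angle of reflection, so the incoming velocity makes the angle `-y.2` with the
tangent.  Since the model is conformal, hyperbolic angles are angles in `ℂ`. -/
def Step (x y : ℍ × ℝ) : Prop :=
  x.2 ∈ Icc 0 Real.pi ∧ y.2 ∈ Icc 0 Real.pi ∧
  ∃ τ σ : ℂ, B.HasTangent x.1 τ ∧ B.HasTangent y.1 σ ∧
  ∃ (γ : ℝ → ℍ) (l : ℝ), Isometry γ ∧ 0 < l ∧ γ 0 = x.1 ∧ γ l = y.1 ∧
    HasDerivAt (fun t => (γ t : ℂ)) (Complex.exp (Complex.I * x.2) * τ) 0 ∧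
    HasDerivAt (fun t => (γ t : ℂ)) (Complex.exp (-(Complex.I * y.2)) * σ) l ∧
    ∀ t ∈ Ioo 0 l, γ t ∈ B.domain

/-- The set of 3-periodic points of the billiard ball map: `T (T (T x)) = x`. -/
def threePeriodic : Set (ℍ × ℝ) :=
  {x | ∃ y z, B.Step x y ∧ B.Step y z ∧ B.Step z x}

/-- The measure `sin φ dφ ds` on (boundary) × `[0, π]`, as a measure on `ℍ × ℝ`:
the sum over the arcs of the images of `sin φ dφ ds` on `[0, len i] × [0, π]`. -/
def liouville : Measure (ℍ × ℝ) :=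
  Measure.sum fun i =>
    (((volume : Measure (ℝ × ℝ)).restrict (Icc 0 (B.len i) ×ˢ Icc 0 Real.pi)).withDensity
      fun q => ENNReal.ofReal (Real.sin q.2)).map fun q => (B.arc i q.1, q.2)

end HyperbolicBilliard

end

open scoped NNReal

noncomputable section

/-! Realise ℍ as a sheet of `lor P P = 1`, where `lor P P` is the determinant of a symmetric 2×2
matrix. There cosh of the distance is a pairing, geodesics are cosh/sinh combinations, and the
normal of a curve is a cross product. A 3-periodic orbit becomes a triangle with vertices on three
arcs, critical for the perimeter L(t₁,t₂,t₃). Let a, d be the sides at the first vertex, b the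
opposite side and φᵢ the reflection angles.

The core is that the parameters of such triangles form a set of Hausdorff dimension at most one
(`dimH_orbitSet_le`). The phase point (s, φ) is a C¹ function of the parameters, so the phase points
also have dimension at most one and hence area zero. Where the minor of the Hessian of L in rows 1,
2 and columns 1, 3 is nonzero, the equations ∂₁L = ∂₂L = 0 are independent. Where it vanishes, the
curvature κ at the first vertex is forced: 2κ = sin φ₁ (sinh(a+d) − sinh b)/(sinh a sinh d). This
relation then replaces ∂₂L = 0. With t₁ frozen, κ is constant, while the right-hand side has nonzero
derivative in the direction tangent to ∂₁L = 0 (`fderiv_curvatureDefect_ne_zero`). Multiplied by cos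
φ₁, that derivative is a sum of three terms of one sign, by the strict triangle inequalities and
because the three cosines share a sign (`IsOrbit.cos_mul_pos`).

Two cases remain. A triangle with a grazing vertex is flat, and its longest side would run through a
boundary point (`sin_pos_of_steps`). The arc ends are countably many, and an orbit whose second or
third vertex is a given one has φ determined by s up to two choices, which gives two curves. -/

/-! ### Linear algebra of the Lorentzian form. -/

/-- The Lorentzian form on `ℝ³` for which the hyperbolic plane is a sheet of `lor P P = 1`. -/
def lor (P Q : ℝ × ℝ × ℝ) : ℝ := (P.1 * Q.2.1 + P.2.1 * Q.1) / 2 - P.2.2 * Q.2.2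

/-- The Lorentzian cross product. -/
def lcross (P Q : ℝ × ℝ × ℝ) : ℝ × ℝ × ℝ :=
  (P.1 * Q.2.2 - P.2.2 * Q.1, P.2.2 * Q.2.1 - P.2.1 * Q.2.2, (P.1 * Q.2.1 - P.2.1 * Q.1) / 2)

theorem lor_comm (P Q : ℝ × ℝ × ℝ) : lor P Q = lor Q P := by simp only [lor]; ring
theorem lor_add_left (P Q R : ℝ × ℝ × ℝ) : lor (P + Q) R = lor P R + lor Q R := by
  simp [lor]; ring
theorem lor_sub_left (P Q R : ℝ × ℝ × ℝ) : lor (P - Q) R = lor P R - lor Q R := by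
  simp [lor]; ring
theorem lor_smul_left (a : ℝ) (P R : ℝ × ℝ × ℝ) : lor (a • P) R = a * lor P R := by
  simp [lor]; ring
theorem lor_add_right (P Q R : ℝ × ℝ × ℝ) : lor R (P + Q) = lor R P + lor R Q := by
  simp [lor]; ring
theorem lor_sub_right (P Q R : ℝ × ℝ × ℝ) : lor R (P - Q) = lor R P - lor R Q := by
  simp [lor]; ring
theorem lor_smul_right (a : ℝ) (P R : ℝ × ℝ × ℝ) : lor R (a • P) = a * lor R P := by
  simp [lor]; ring
theorem lcross_add_left (P Q R : ℝ × ℝ × ℝ) : lcross (P + Q) R = lcross P R + lcross Q R := by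
  ext <;> simp [lcross] <;> ring
theorem lcross_smul_left (a : ℝ) (P R : ℝ × ℝ × ℝ) : lcross (a • P) R = a • lcross P R := by
  ext <;> simp [lcross] <;> ring
theorem lcross_add_right (P Q R : ℝ × ℝ × ℝ) : lcross R (P + Q) = lcross R P + lcross R Q := by
  ext <;> simp [lcross] <;> ring
theorem lcross_sub_right (P Q R : ℝ × ℝ × ℝ) : lcross R (P - Q) = lcross R P - lcross R Q := by
  ext <;> simp [lcross] <;> ring
theorem lcross_smul_right (a : ℝ) (P R : ℝ × ℝ × ℝ) : lcross R (a • P) = a • lcross R P := by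
  ext <;> simp [lcross] <;> ring
theorem lcross_anticomm (P Q : ℝ × ℝ × ℝ) : lcross P Q = -lcross Q P := by
  ext <;> simp only [lcross, Prod.fst_neg, Prod.snd_neg] <;> ring
theorem lcross_self (P : ℝ × ℝ × ℝ) : lcross P P = 0 := by
  ext <;> simp [lcross] <;> ring
theorem lcross_lcross (P Q R : ℝ × ℝ × ℝ) :
    lcross P (lcross Q R) = lor P R • Q - lor P Q • R := by
  ext <;> simp [lcross, lor] <;> ring
theorem lor_lcross_rotate (P Q R : ℝ × ℝ × ℝ) : lor P (lcross Q R) = lor Q (lcross R P) := by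
  simp only [lcross, lor]; ring
theorem lor_lcross_self (P Q : ℝ × ℝ × ℝ) : lor P (lcross P Q) = 0 := by
  simp only [lcross, lor]; ring
theorem lor_lcross_self_right (P Q : ℝ × ℝ × ℝ) : lor Q (lcross P Q) = 0 := by
  simp only [lcross, lor]; ring
theorem lor_lcross_lcross (P Q R S : ℝ × ℝ × ℝ) :
    lor (lcross P Q) (lcross R S) = lor P R * lor Q S - lor P S * lor Q R := by
  simp only [lcross, lor]; ring

/-- A null vector orthogonal to a timelike one vanishes. -/
theorem eq_zero_of_lor_eq_zero {P R : ℝ × ℝ × ℝ} (hP : lor P P = 1) (hR : lor R R = 0)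
    (h : lor R P = 0) : R = 0 := by
  obtain ⟨A, B, C⟩ := P
  obtain ⟨r, s, t⟩ := R
  simp only [lor] at *
  -- Definiteness of the form on the complement of a timelike vector, made explicit as a sum of
  -- squares.
  have h1 : (A * s - B * r) ^ 2 + 4 * t ^ 2 = 0 := by
    linear_combination 2 * (A * s + B * r + 2 * C * t) * h - 4 * r * s * hP - 4 * (1 + C ^ 2) * hR
  have ht : t = 0 := by nlinarith [sq_nonneg (A * s - B * r), sq_nonneg t]
  have h2 : A * s - B * r = 0 := by nlinarith [sq_nonneg (A * s - B * r), sq_nonneg t]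
  subst ht
  have h3 : A * s = 0 := by linarith
  have h4 : B * r = 0 := by linarith
  have hA : A ≠ 0 := by rintro rfl; nlinarith [sq_nonneg C]
  have hB : B ≠ 0 := by rintro rfl; nlinarith [sq_nonneg C]
  simp only [mul_eq_zero, hA, hB, false_or] at h3 h4
  simp [h3, h4]

/-! ### Frames, chords and billiard triangles. -/

/-- `X` is a point of the hyperbolic plane and `T` a unit tangent vector there. -/
structure IsFrame (X T : ℝ × ℝ × ℝ) : Prop where
  point : lor X X = 1
  orth : lor X T = 0
  unit : lor T T = -1

/-- Crossing with the base point is a quarter turn of the tangent plane, so `lcross X T` serves as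
the unit normal. -/
theorem IsFrame.lcross_lcross {X T : ℝ × ℝ × ℝ} (h : IsFrame X T) :
    lcross X (lcross X T) = -T := by
  rw [_root_.lcross_lcross, h.point, h.orth]; simp

theorem IsFrame.lcross_tangent_normal {X T : ℝ × ℝ × ℝ} (h : IsFrame X T) :
    lcross T (lcross X T) = -X := by
  rw [_root_.lcross_lcross, lor_comm T X, h.unit, h.orth]; simp

theorem IsFrame.normal_unit {X T : ℝ × ℝ × ℝ} (h : IsFrame X T) :
    lor (lcross X T) (lcross X T) = -1 := by
  rw [lor_lcross_lcross, h.unit, h.orth, h.point]; simp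

/-- A vector with the given pairings with the point and the unit tangent vector is determined up
to its normal component. -/
theorem IsFrame.eq_add_smul_normal {X T Q : ℝ × ℝ × ℝ} (h : IsFrame X T)
    (hX : lor Q X = 1) (hT : lor Q T = 0) :
    Q = X - lor Q (lcross X T) • lcross X T := by
  have hN := h.normal_unit
  have hXN := lor_lcross_self X T
  have hTN := lor_lcross_self_right X T
  set D := Q - (X - lor Q (lcross X T) • lcross X T) with hD
  have h1 : lor D X = 0 := by
    simp [hD, lor_sub_left, lor_smul_left, hX, h.point, lor_comm (lcross X T), hXN]
  have h2 : lor D T = 0 := by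
    simp [hD, lor_sub_left, lor_smul_left, hT, h.orth, lor_comm (lcross X T), hTN]
  have h3 : lor (lcross X T) D = 0 := by
    rw [lor_comm]
    simp [hD, lor_sub_left, lor_smul_left, hXN, hN]
  -- `D` is orthogonal to the whole frame; the double cross product with the normal then returns `D`
  -- itself and shows that it is zero.
  have h4 : lcross (lcross X T) D = 0 := by
    rw [lcross_anticomm, _root_.lcross_lcross, h1, h2]; simp
  have h5 := _root_.lcross_lcross (lcross X T) (lcross X T) D
  rw [h4, h3, hN] at h5
  have h6 : D = 0 := by
    have : lcross (lcross X T) 0 = 0 := by ext <;> simp [lcross]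
    rw [this] at h5
    simpa using h5.symm
  exact sub_eq_zero.1 h6

theorem IsFrame.lor_combination {X T : ℝ × ℝ × ℝ} (h : IsFrame X T) (p q r p' q' r' : ℝ) :
    lor (p • X + q • T + r • lcross X T) (p' • X + q' • T + r' • lcross X T) =
      p * p' - q * q' - r * r' := by
  have h1 := h.point
  have h2 := h.orth
  have h3 := h.unit
  have h4 := h.normal_unit
  have h5 := lor_lcross_self X T
  have h6 := lor_lcross_self_right X T
  have h7 := lor_comm T X
  have h8 := lor_comm (lcross X T) X
  have h9 := lor_comm (lcross X T) T
  simp only [lor_add_right, lor_add_left, lor_smul_right, lor_smul_left, h1, h2, h3, h4, h5, h6,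
    h7, h8, h9]
  ring

theorem IsFrame.lor_lcross_combination {X T : ℝ × ℝ × ℝ} (h : IsFrame X T)
    (p q r p' q' r' : ℝ) :
    lor X (lcross (p • X + q • T + r • lcross X T) (p' • X + q' • T + r' • lcross X T)) =
      r * q' - q * r' := by
  have h1 : lcross T (lcross X T) = (-1 : ℝ) • X := by simp [h.lcross_tangent_normal]
  have h2 : lcross (lcross X T) T = X := by
    rw [lcross_anticomm, h.lcross_tangent_normal, neg_neg]
  have h3 : lcross (lcross X T) X = T := by
    rw [lcross_anticomm, h.lcross_lcross, neg_neg]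
  have h4 : lcross T X = (-1 : ℝ) • lcross X T := by rw [lcross_anticomm]; simp
  have h5 : lcross X (lcross X T) = (-1 : ℝ) • T := by simp [h.lcross_lcross]
  have h6 : lor X 0 = 0 := by simp [lor]
  simp only [lcross_add_right, lcross_add_left, lcross_smul_right, lcross_smul_left, lcross_self,
    lor_add_right, lor_smul_right, h1, h2, h3, h4, h5, h6, h.point, h.orth, lor_lcross_self]
  ring

/-- The geodesic segment of length `l` from the point `X` with unit tangent vector `T` to the point
`Y` with unit tangent vector `S`: it leaves at the angle with cosine and sine `c`, `s` to `T` and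
arrives at the angle with cosine and sine `c'`, `-s'` to `S`. -/
structure IsChord (X T Y S : ℝ × ℝ × ℝ) (l c s c' s' : ℝ) : Prop where
  pos : 0 < l
  circle : c ^ 2 + s ^ 2 = 1
  circle' : c' ^ 2 + s' ^ 2 = 1
  target : Y = Real.cosh l • X + Real.sinh l • (c • T + s • lcross X T)
  source : X = Real.cosh l • Y - Real.sinh l • (c' • S - s' • lcross Y S)

section Chord

variable {X T Y S : ℝ × ℝ × ℝ} {l c s c' s' : ℝ}

/-- Reversing the chord negates both velocities: the cosines change sign, the sines do not. -/
theorem IsChord.symm (h : IsChord X T Y S l c s c' s') :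
    IsChord Y S X T l (-c') s' (-c) s where
  pos := h.pos
  circle := by linear_combination h.circle'
  circle' := by linear_combination h.circle
  target := by
    nth_rw 1 [h.source]; module
  source := by
    nth_rw 1 [h.target]; module

theorem IsChord.lor_points (h : IsChord X T Y S l c s c' s') (hX : IsFrame X T) :
    lor X Y = Real.cosh l := by
  rw [h.target]
  simp [lor_add_right, lor_smul_right, hX.point, hX.orth, lor_lcross_self]

theorem IsChord.lor_tangent_target (h : IsChord X T Y S l c s c' s') (hX : IsFrame X T) :
    lor T Y = -(Real.sinh l * c) := by
  rw [h.target]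
  simp [lor_add_right, lor_smul_right, hX.unit, lor_comm T X, hX.orth, lor_lcross_self_right]

theorem IsChord.lor_normal_target (h : IsChord X T Y S l c s c' s') (hX : IsFrame X T) :
    lor (lcross X T) Y = -(Real.sinh l * s) := by
  rw [h.target]
  simp [lor_add_right, lor_smul_right, lor_comm _ X, lor_comm _ T, lor_lcross_self,
    hX.normal_unit, lor_lcross_self_right]

/-- Both sides are the unit normal of the geodesic, `lcross X Y` divided by `sinh l`. -/
theorem IsChord.normal_eq (h : IsChord X T Y S l c s c' s') (hX : IsFrame X T)
    (hY : IsFrame Y S) : c • lcross X T - s • T = c' • lcross Y S + s' • S := by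
  have h1 : lcross X Y = Real.sinh l • (c • lcross X T - s • T) := by
    rw [h.target]
    simp only [lcross_add_right, lcross_smul_right, lcross_self, hX.lcross_lcross]
    module
  have h2 : lcross Y X = - (Real.sinh l • (c' • lcross Y S + s' • S)) := by
    rw [h.source]
    simp only [lcross_sub_right, lcross_smul_right, lcross_self, hY.lcross_lcross]
    module
  rw [lcross_anticomm, h2, neg_neg] at h1
  exact (smul_right_injective _ (Real.sinh_pos_iff.2 h.pos).ne' h1).symm

/-- At `Y` the arrival velocity and the normal of the geodesic are orthonormal, and `S` has
coordinates `c'`, `s'` in them; both vectors are then expressed in the frame at `X`. -/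
theorem IsChord.tangent_eq (h : IsChord X T Y S l c s c' s') (hX : IsFrame X T)
    (hY : IsFrame Y S) :
    S = (c' * Real.sinh l) • X + (c' * Real.cosh l) • (c • T + s • lcross X T)
      + s' • (c • lcross X T - s • T) := by
  have h0 : Real.sinh l ≠ 0 := (Real.sinh_pos_iff.2 h.pos).ne'
  have h1 : S = c' • (c' • S - s' • lcross Y S) + s' • (c' • lcross Y S + s' • S) := by
    have : S = (c' ^ 2 + s' ^ 2) • S := by rw [h.circle', one_smul]
    nth_rw 1 [this]; module
  have h2 : c' • S - s' • lcross Y S =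
      Real.sinh l • X + Real.cosh l • (c • T + s • lcross X T) := by
    apply smul_right_injective _ h0
    simp only
    have e : Real.sinh l • (c' • S - s' • lcross Y S) = Real.cosh l • Y - X := by
      rw [eq_sub_iff_add_eq, add_comm, ← eq_sub_iff_add_eq]; exact h.source
    rw [e]
    nth_rw 1 [h.target]
    have : Real.cosh l * Real.cosh l = 1 + Real.sinh l * Real.sinh l := by
      linear_combination Real.cosh_sq l
    simp only [smul_add, smul_smul]
    rw [this]
    module
  rw [← h.normal_eq hX hY, h2] at h1
  nth_rw 1 [h1]
  module

theorem IsChord.lor_tangents (h : IsChord X T Y S l c s c' s') (hX : IsFrame X T)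
    (hY : IsFrame Y S) : lor T S = s * s' - c * c' * Real.cosh l := by
  rw [h.tangent_eq hX hY]
  simp [lor_add_right, lor_sub_right, lor_smul_right, hX.unit, lor_comm T X, hX.orth,
    lor_lcross_self_right]
  ring

theorem IsChord.lor_normal_tangent (h : IsChord X T Y S l c s c' s') (hX : IsFrame X T)
    (hY : IsFrame Y S) : lor (lcross X T) S = -(s * c' * Real.cosh l) - c * s' := by
  rw [h.tangent_eq hX hY]
  simp [lor_add_right, lor_sub_right, lor_smul_right, lor_comm _ X, lor_comm _ T,
    lor_lcross_self, hX.normal_unit, lor_lcross_self_right]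
  ring

end Chord

section Triangle

variable {X₁ T₁ X₂ T₂ X₃ T₃ : ℝ × ℝ × ℝ} {a b d c₁ s₁ c₂ s₂ c₃ s₃ : ℝ}

/-- A billiard triangle: three chords reflected at the vertices, in the cyclic order
`X₁ → X₂ → X₃ → X₁`. -/
structure IsOrbit (X₁ T₁ X₂ T₂ X₃ T₃ : ℝ × ℝ × ℝ) (a b d c₁ s₁ c₂ s₂ c₃ s₃ : ℝ) : Prop where
  frame₁ : IsFrame X₁ T₁
  frame₂ : IsFrame X₂ T₂
  frame₃ : IsFrame X₃ T₃
  chord₁ : IsChord X₁ T₁ X₂ T₂ a c₁ s₁ c₂ s₂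
  chord₂ : IsChord X₂ T₂ X₃ T₃ b c₂ s₂ c₃ s₃
  chord₃ : IsChord X₃ T₃ X₁ T₁ d c₃ s₃ c₁ s₁

theorem IsOrbit.rotate (h : IsOrbit X₁ T₁ X₂ T₂ X₃ T₃ a b d c₁ s₁ c₂ s₂ c₃ s₃) :
    IsOrbit X₂ T₂ X₃ T₃ X₁ T₁ b d a c₂ s₂ c₃ s₃ c₁ s₁ :=
  ⟨h.frame₂, h.frame₃, h.frame₁, h.chord₂, h.chord₃, h.chord₁⟩

theorem IsOrbit.source_eq (h : IsOrbit X₁ T₁ X₂ T₂ X₃ T₃ a b d c₁ s₁ c₂ s₂ c₃ s₃) :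
    X₁ = Real.cosh a • X₂ + (-(Real.sinh a * c₂)) • T₂ + (Real.sinh a * s₂) • lcross X₂ T₂ := by
  rw [h.chord₁.source]; module

theorem IsOrbit.target_eq (h : IsOrbit X₁ T₁ X₂ T₂ X₃ T₃ a b d c₁ s₁ c₂ s₂ c₃ s₃) :
    X₃ = Real.cosh b • X₂ + (Real.sinh b * c₂) • T₂ + (Real.sinh b * s₂) • lcross X₂ T₂ := by
  rw [h.chord₂.target]; module

/-- Law of cosines: the angle at a vertex is `π - 2φ`. -/
theorem IsOrbit.cosh_eq (h : IsOrbit X₁ T₁ X₂ T₂ X₃ T₃ a b d c₁ s₁ c₂ s₂ c₃ s₃) :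
    Real.cosh d = Real.cosh (a + b) - 2 * s₂ ^ 2 * (Real.sinh a * Real.sinh b) := by
  rw [← h.chord₃.lor_points h.frame₃, h.source_eq, h.target_eq, h.frame₂.lor_combination,
    Real.cosh_add]
  linear_combination (Real.sinh a * Real.sinh b) * h.chord₂.circle

/-- The strict triangle inequality: by the law of cosines the deficit is positive unless the middle
vertex grazes. -/
theorem IsOrbit.lt_add (h : IsOrbit X₁ T₁ X₂ T₂ X₃ T₃ a b d c₁ s₁ c₂ s₂ c₃ s₃) (hs : s₂ ≠ 0) :
    d < a + b := by
  have h1 := h.cosh_eq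
  have h2 : 0 < 2 * s₂ ^ 2 * (Real.sinh a * Real.sinh b) := by
    have := Real.sinh_pos_iff.2 h.chord₁.pos
    have := Real.sinh_pos_iff.2 h.chord₂.pos
    positivity
  have h3 : Real.cosh d < Real.cosh (a + b) := by linarith
  rw [Real.cosh_lt_cosh] at h3
  rwa [abs_of_pos h.chord₃.pos, abs_of_pos (add_pos h.chord₁.pos h.chord₂.pos)] at h3

theorem IsOrbit.eq_add (h : IsOrbit X₁ T₁ X₂ T₂ X₃ T₃ a b d c₁ s₁ c₂ s₂ c₃ s₃) (hs : s₂ = 0) :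
    d = a + b := by
  have h1 := h.cosh_eq
  have h3 : Real.cosh d = Real.cosh (a + b) := by rw [h1, hs]; ring
  have := h.chord₃.pos
  have := h.chord₁.pos
  have := h.chord₂.pos
  exact Real.cosh_strictMonoOn.injOn (by simp; linarith) (by simp; linarith) h3

/-- The orientation determinant of a billiard triangle. -/
theorem IsOrbit.det_eq (h : IsOrbit X₁ T₁ X₂ T₂ X₃ T₃ a b d c₁ s₁ c₂ s₂ c₃ s₃) :
    lor X₁ (lcross X₂ X₃) = -(2 * (Real.sinh a * Real.sinh b) * (c₂ * s₂)) := by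
  rw [lor_lcross_rotate, h.source_eq, h.target_eq, h.frame₂.lor_lcross_combination]
  ring

/-- In a billiard triangle without grazing vertices, the three reflection angles lie on the same
side of the right angle. -/
theorem IsOrbit.cos_mul_pos (h : IsOrbit X₁ T₁ X₂ T₂ X₃ T₃ a b d c₁ s₁ c₂ s₂ c₃ s₃)
    (h₁ : 0 < s₁) (h₂ : 0 < s₂) (h₃ : 0 < s₃) : 0 < c₁ * c₂ ∧ 0 < c₁ * c₃ := by
  have ha := Real.sinh_pos_iff.2 h.chord₁.pos
  have hb := Real.sinh_pos_iff.2 h.chord₂.pos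
  have hd := Real.sinh_pos_iff.2 h.chord₃.pos
  -- The determinant is invariant under cyclic rotation, so its three expressions agree and all
  -- products `cᵢ * sᵢ` have the same sign.
  have e₂ := h.det_eq
  have e₃ := h.rotate.det_eq
  have e₁ := h.rotate.rotate.det_eq
  rw [← lor_lcross_rotate] at e₃
  rw [lor_lcross_rotate] at e₁
  have hc : c₁ ≠ 0 := by
    rintro rfl
    rw [e₂] at e₁ e₃
    have h2 : c₂ = 0 := by
      have : Real.sinh a * Real.sinh b * s₂ * c₂ = 0 := by linear_combination (-1 / 2) * e₁
      simpa [ha.ne', hb.ne', h₂.ne'] using this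
    subst h2
    have h3 : c₃ = 0 := by
      have : Real.sinh b * Real.sinh d * s₃ * c₃ = 0 := by linear_combination (1 / 2) * e₃
      simpa [hb.ne', hd.ne', h₃.ne'] using this
    subst h3
    have f₂ := h.cosh_eq
    have f₃ := h.rotate.cosh_eq
    have f₁ := h.rotate.rotate.cosh_eq
    have g₁ : s₁ ^ 2 = 1 := by linear_combination h.chord₃.circle'
    have g₂ : s₂ ^ 2 = 1 := by linear_combination h.chord₁.circle'
    have g₃ : s₃ ^ 2 = 1 := by linear_combination h.chord₂.circle'
    -- If all three reflections were perpendicular, each side would be the absolute difference of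
    -- the other two, which fails for the longest.
    have f₂' : Real.cosh d = Real.cosh (a - b) := by
      rw [f₂, g₂, Real.cosh_add, Real.cosh_sub]; ring
    have f₃' : Real.cosh a = Real.cosh (b - d) := by
      rw [f₃, g₃, Real.cosh_add, Real.cosh_sub]; ring
    have f₁' : Real.cosh b = Real.cosh (d - a) := by
      rw [f₁, g₁, Real.cosh_add, Real.cosh_sub]; ring
    have k₁ := abs_eq_abs.1 (le_antisymm (Real.cosh_le_cosh.1 f₁'.le) (Real.cosh_le_cosh.1 f₁'.ge))
    have k₂ := abs_eq_abs.1 (le_antisymm (Real.cosh_le_cosh.1 f₂'.le) (Real.cosh_le_cosh.1 f₂'.ge))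
    have k₃ := abs_eq_abs.1 (le_antisymm (Real.cosh_le_cosh.1 f₃'.le) (Real.cosh_le_cosh.1 f₃'.ge))
    have := h.chord₁.pos
    have := h.chord₂.pos
    have := h.chord₃.pos
    rcases k₁ with k₁ | k₁ <;> rcases k₂ with k₂ | k₂ <;> rcases k₃ with k₃ | k₃ <;> linarith
  rw [e₂] at e₁ e₃
  have hp : 0 < Real.sinh d * Real.sinh a * s₁ * c₁ ^ 2 := by positivity
  constructor
  · have : 0 < Real.sinh a * Real.sinh b * s₂ * (c₁ * c₂) := by linear_combination hp + c₁ / 2 * e₁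
    exact (mul_pos_iff_of_pos_left (by positivity)).1 this
  · have : 0 < Real.sinh b * Real.sinh d * s₃ * (c₁ * c₃) := by
      linear_combination hp + c₁ / 2 * e₁ - c₁ / 2 * e₃
    exact (mul_pos_iff_of_pos_left (by positivity)).1 this

end Triangle

/-! ### Hausdorff dimension of zero sets and images. -/

/-- A set in which every point has a neighbourhood of dimension at most `d` has dimension at most
`d`. -/
theorem dimH_le_of_locally {E : Type*} [EMetricSpace E] [SecondCountableTopology E] {Z : Set E}
    {d : ENNReal} (h : ∀ z ∈ Z, ∃ U ∈ 𝓝[Z] z, dimH U ≤ d) : dimH Z ≤ d := by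
  by_contra! hd
  obtain ⟨z, hz, hU⟩ := exists_mem_nhdsWithin_lt_dimH_of_lt_dimH hd
  obtain ⟨U, hUz, hle⟩ := h z hz
  exact (hU U hUz).not_ge hle

/-- The common zeros in `ℝ³` of two functions with independent derivatives form a set of dimension
at most one. -/
theorem dimH_le_one_of_independent {Z : Set (ℝ × ℝ × ℝ)} {f g : ℝ × ℝ × ℝ → ℝ}
    (hf0 : ∀ z ∈ Z, f z = 0) (hg0 : ∀ z ∈ Z, g z = 0)
    (hf : ∀ z ∈ Z, ContDiffAt ℝ 1 f z) (hg : ∀ z ∈ Z, ContDiffAt ℝ 1 g z)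
    (h : ∀ z ∈ Z, ∃ v w, fderiv ℝ f z v * fderiv ℝ g z w ≠ fderiv ℝ f z w * fderiv ℝ g z v) :
    dimH Z ≤ 1 := by
  refine dimH_le_of_locally fun z hz => ?_
  obtain ⟨v, w, hvw⟩ := h z hz
  have hF : HasStrictFDerivAt (fun x => (f x, g x)) ((fderiv ℝ f z).prod (fderiv ℝ g z)) z :=
    ((hf z hz).hasStrictFDerivAt one_ne_zero).prodMk ((hg z hz).hasStrictFDerivAt one_ne_zero)
  set F' := (fderiv ℝ f z).prod (fderiv ℝ g z) with hF'
  have hsurj : Function.Surjective F' := by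
    rintro ⟨p, q⟩
    set a := fderiv ℝ f z v
    set b := fderiv ℝ f z w
    set c := fderiv ℝ g z v
    set d := fderiv ℝ g z w
    have hD : a * d - b * c ≠ 0 := sub_ne_zero.2 hvw
    -- Cramer's rule.
    refine ⟨((p * d - b * q) / (a * d - b * c)) • v + ((a * q - p * c) / (a * d - b * c)) • w, ?_⟩
    simp only [hF', ContinuousLinearMap.prod_apply, map_add, map_smul]
    have h1 : (p * d - b * q) / (a * d - b * c) * a + (a * q - p * c) / (a * d - b * c) * b = p := by
      rw [div_mul_eq_mul_div, div_mul_eq_mul_div, ← add_div, div_eq_iff hD]; ring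
    have h2 : (p * d - b * q) / (a * d - b * c) * c + (a * q - p * c) / (a * d - b * c) * d = q := by
      rw [div_mul_eq_mul_div, div_mul_eq_mul_div, ← add_div, div_eq_iff hD]; ring
    exact Prod.ext h1 h2
  have hrange : F'.range = ⊤ := LinearMap.range_eq_top.2 hsurj
  have hker : Module.finrank ℝ F'.ker = 1 := by
    have := LinearMap.finrank_range_add_finrank_ker F'.toLinearMap
    rw [show F'.toLinearMap.range = ⊤ from hrange] at this
    simp at this
    change Module.finrank ℝ (F'.toLinearMap).ker = 1
    omega
  let D := hF.implicitFunctionDataOfComplemented _ _ hrange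
    F'.ker_closedComplemented_of_finiteDimensional_range
  obtain ⟨e, he⟩ : ∃ e : (ℝ × ℝ × ℝ) ≃L[ℝ] ((ℝ × ℝ) × F'.ker),
      HasStrictFDerivAt D.prodFun (e : (ℝ × ℝ × ℝ) →L[ℝ] ((ℝ × ℝ) × F'.ker)) z :=
    ⟨_, D.hasStrictFDerivAt⟩
  obtain ⟨s, hzs, hso, happ⟩ := he.approximates_deriv_on_open_nhds
  obtain ⟨K, hK⟩ : ∃ K, AntilipschitzWith K (s.domRestrict D.prodFun) :=
    ⟨_, happ.antilipschitz (by
      refine e.subsingleton_or_nnnorm_symm_pos.imp id fun hp => ?_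
      exact NNReal.half_lt_self (inv_pos.2 hp).ne')⟩
  refine ⟨s ∩ Z, inter_comm s Z ▸ inter_mem_nhdsWithin Z (hso.mem_nhds hzs), ?_⟩
  -- On `Z` the component `D.leftFun` is constantly zero, so the local diffeomorphism `D.prodFun`
  -- separates points of `Z` through `D.rightFun` alone, which takes values in a line.
  have hanti : AntilipschitzWith K (fun x : ↥(s ∩ Z) => D.rightFun x) := by
    intro x y
    have h1 := hK ⟨x, x.2.1⟩ ⟨y, y.2.1⟩
    have h2 : D.leftFun x = D.leftFun y := by
      change (f x, g x) = (f y, g y)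
      rw [hf0 _ x.2.2, hf0 _ y.2.2, hg0 _ x.2.2, hg0 _ y.2.2]
    refine h1.trans_eq ?_
    simp [Set.domRestrict, ImplicitFunctionData.prodFun_apply, Prod.edist_eq, h2]
  have h3 := hanti.le_dimH_image univ
  have h4 : dimH (Subtype.val '' (univ : Set ↥(s ∩ Z))) = dimH (univ : Set ↥(s ∩ Z)) :=
    isometry_subtype_coe.dimH_image _
  rw [image_univ, Subtype.range_coe] at h4
  rw [h4]
  refine h3.trans ((dimH_mono (subset_univ _)).trans ?_)
  have := Real.dimH_univ_eq_finrank F'.ker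
  rw [hker] at this
  exact_mod_cast this.le

/-- Maps that are continuously differentiable at the points of a set do not increase its
dimension. -/
theorem dimH_image_le_of_contDiffAt {E F : Type*} [NormedAddCommGroup E] [NormedSpace ℝ E]
    [FiniteDimensional ℝ E] [NormedAddCommGroup F] [NormedSpace ℝ F] {Z : Set E} {f : E → F}
    (hf : ∀ z ∈ Z, ContDiffAt ℝ 1 f z) : dimH (f '' Z) ≤ dimH Z := by
  refine dimH_image_le_of_locally_lipschitzOn fun z hz => ?_
  obtain ⟨K, t, ht, hK⟩ := (hf z hz).exists_lipschitzOnWith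
  exact ⟨K, t, mem_nhdsWithin_of_mem_nhds ht, hK⟩

theorem volume_eq_zero_of_dimH_le_one {Z : Set (ℝ × ℝ)} (h : dimH Z ≤ 1) :
    (volume : Measure (ℝ × ℝ)) Z = 0 := by
  rw [← hausdorffMeasure_prod_real]
  exact_mod_cast hausdorffMeasure_of_dimH_lt (d := 2) (h.trans_lt (by norm_num))

/-! ### Calculus for the form and the distance. -/

theorem fderiv_apply_first {f : ℝ × ℝ × ℝ → ℝ} {z : ℝ × ℝ × ℝ} {D : ℝ}
    (hf : DifferentiableAt ℝ f z) (h : HasDerivAt (fun t => f (t, z.2.1, z.2.2)) D z.1) :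
    fderiv ℝ f z (1, 0, 0) = D :=
  HasDerivAt.unique (HasFDerivAt.comp_hasDerivAt_of_eq z.1 hf.hasFDerivAt
    ((hasDerivAt_id z.1).prodMk ((hasDerivAt_const _ _).prodMk (hasDerivAt_const _ _))) rfl) h

theorem fderiv_apply_second {f : ℝ × ℝ × ℝ → ℝ} {z : ℝ × ℝ × ℝ} {D : ℝ}
    (hf : DifferentiableAt ℝ f z) (h : HasDerivAt (fun t => f (z.1, t, z.2.2)) D z.2.1) :
    fderiv ℝ f z (0, 1, 0) = D :=
  HasDerivAt.unique (HasFDerivAt.comp_hasDerivAt_of_eq z.2.1 hf.hasFDerivAt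
    ((hasDerivAt_const _ _).prodMk ((hasDerivAt_id z.2.1).prodMk (hasDerivAt_const _ _))) rfl) h

theorem fderiv_apply_third {f : ℝ × ℝ × ℝ → ℝ} {z : ℝ × ℝ × ℝ} {D : ℝ}
    (hf : DifferentiableAt ℝ f z) (h : HasDerivAt (fun t => f (z.1, z.2.1, t)) D z.2.2) :
    fderiv ℝ f z (0, 0, 1) = D :=
  HasDerivAt.unique (HasFDerivAt.comp_hasDerivAt_of_eq z.2.2 hf.hasFDerivAt
    ((hasDerivAt_const _ _).prodMk ((hasDerivAt_const _ _).prodMk (hasDerivAt_id z.2.2))) rfl) h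

theorem HasDerivAt.lor {f g : ℝ → ℝ × ℝ × ℝ} {f' g' : ℝ × ℝ × ℝ} {t : ℝ} (hf : HasDerivAt f f' t)
    (hg : HasDerivAt g g' t) :
    HasDerivAt (fun u => lor (f u) (g u)) (lor f' (g t) + lor (f t) g') t := by
  have f1 : HasDerivAt (fun u => (f u).1) f'.1 t := hf.fst
  have f2 : HasDerivAt (fun u => (f u).2.1) f'.2.1 t := hf.snd.fst
  have f3 : HasDerivAt (fun u => (f u).2.2) f'.2.2 t := hf.snd.snd
  have g1 : HasDerivAt (fun u => (g u).1) g'.1 t := hg.fst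
  have g2 : HasDerivAt (fun u => (g u).2.1) g'.2.1 t := hg.snd.fst
  have g3 : HasDerivAt (fun u => (g u).2.2) g'.2.2 t := hg.snd.snd
  refine ((((f1.mul g2).add (f2.mul g1)).div_const 2).sub (f3.mul g3)).congr_deriv ?_
  simp only [_root_.lor]; ring

theorem ContDiffAt.lor {E : Type*} [NormedAddCommGroup E] [NormedSpace ℝ E] {n : WithTop ℕ∞}
    {f g : E → ℝ × ℝ × ℝ} {x : E} (hf : ContDiffAt ℝ n f x) (hg : ContDiffAt ℝ n g x) :
    ContDiffAt ℝ n (fun u => lor (f u) (g u)) x := by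
  unfold _root_.lor; fun_prop

theorem ContDiffAt.lcross {E : Type*} [NormedAddCommGroup E] [NormedSpace ℝ E] {n : WithTop ℕ∞}
    {f g : E → ℝ × ℝ × ℝ} {x : E} (hf : ContDiffAt ℝ n f x) (hg : ContDiffAt ℝ n g x) :
    ContDiffAt ℝ n (fun u => lcross (f u) (g u)) x := by
  unfold _root_.lcross; fun_prop

theorem ContDiffAt.deriv_of_top {f : ℝ → ℝ × ℝ × ℝ} {x : ℝ} (hf : ContDiffAt ℝ ∞ f x) :
    ContDiffAt ℝ ∞ (deriv f) x :=
  (hf.fderiv_right (m := ∞) (by simp)).clm_apply contDiffAt_const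

/-- The hyperbolic sine of the distance of two points. -/
def sinhDist (P Q : ℝ × ℝ × ℝ) : ℝ := √(lor P Q ^ 2 - 1)

theorem sinhDist_comm (P Q : ℝ × ℝ × ℝ) : sinhDist P Q = sinhDist Q P := by
  simp only [sinhDist, lor_comm]

theorem sinhDist_eq {P Q : ℝ × ℝ × ℝ} {l : ℝ} (hl : 0 < l) (h : lor P Q = Real.cosh l) :
    sinhDist P Q = Real.sinh l := by
  rw [sinhDist, h, Real.cosh_sq, add_sub_cancel_right, Real.sqrt_sq (Real.sinh_pos_iff.2 hl).le]

theorem HasDerivAt.sinhDist {f g : ℝ → ℝ × ℝ × ℝ} {t l D : ℝ} (hl : 0 < l)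
    (h : _root_.lor (f t) (g t) = Real.cosh l)
    (hfg : HasDerivAt (fun u => _root_.lor (f u) (g u)) D t) :
    HasDerivAt (fun u => sinhDist (f u) (g u)) (Real.cosh l * D / Real.sinh l) t := by
  have hs := Real.sinh_pos_iff.2 hl
  have h2 : _root_.lor (f t) (g t) ^ 2 - 1 ≠ 0 := by
    rw [h, Real.cosh_sq, add_sub_cancel_right]; positivity
  have h3 := ((hfg.fun_pow 2).sub_const 1).sqrt h2
  have h4 := sinhDist_eq hl h
  unfold _root_.sinhDist at h4 ⊢
  refine h3.congr_deriv ?_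
  rw [h4, h]
  push_cast
  field_simp

theorem ContDiffAt.sinhDist {E : Type*} [NormedAddCommGroup E] [NormedSpace ℝ E]
    {n : WithTop ℕ∞} {f g : E → ℝ × ℝ × ℝ} {x : E} {l : ℝ} (hl : 0 < l)
    (h : _root_.lor (f x) (g x) = Real.cosh l) (hf : ContDiffAt ℝ n f x)
    (hg : ContDiffAt ℝ n g x) : ContDiffAt ℝ n (fun u => sinhDist (f u) (g u)) x := by
  have hs := Real.sinh_pos_iff.2 hl
  have h2 : _root_.lor (f x) (g x) ^ 2 - 1 ≠ 0 := by
    rw [h, Real.cosh_sq, add_sub_cancel_right]; positivity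
  exact (((hf.lor hg).pow 2).sub contDiffAt_const).sqrt h2

/-! ### Unit speed curves and variation of chords. -/

/-- A curve in the hyperbolic plane, near a time at which it is smooth and of unit speed. -/
structure IsUnitCurveAt (X : ℝ → ℝ × ℝ × ℝ) (t : ℝ) : Prop where
  smooth : ContDiffAt ℝ ∞ X t
  frame : ∀ᶠ u in 𝓝 t, IsFrame (X u) (deriv X u)

section Curve

variable {X : ℝ → ℝ × ℝ × ℝ} {t : ℝ}

theorem IsUnitCurveAt.hasDerivAt (h : IsUnitCurveAt X t) : HasDerivAt X (deriv X t) t :=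
  (h.smooth.differentiableAt (by simp)).hasDerivAt

theorem IsUnitCurveAt.hasDerivAt_deriv (h : IsUnitCurveAt X t) :
    HasDerivAt (deriv X) (deriv (deriv X) t) t :=
  (h.smooth.deriv_of_top.differentiableAt (by simp)).hasDerivAt

/-- The geodesic curvature of a curve in the hyperbolic plane. -/
def geodesicCurvature (X : ℝ → ℝ × ℝ × ℝ) (t : ℝ) : ℝ :=
  -lor (deriv (deriv X) t) (lcross (X t) (deriv X t))

/-- Differentiating the frame relations gives the pairings 1 and 0 of the second derivative with
point and tangent; only the normal component, the curvature, is free. -/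
theorem IsUnitCurveAt.frenet (h : IsUnitCurveAt X t) :
    deriv (deriv X) t = X t + geodesicCurvature X t • lcross (X t) (deriv X t) := by
  have hF := h.frame.self_of_nhds
  have h1 : lor (deriv X t) (deriv X t) + lor (X t) (deriv (deriv X) t) = 0 := by
    refine (h.hasDerivAt.lor h.hasDerivAt_deriv).unique ?_
    exact (hasDerivAt_const t (0 : ℝ)).congr_of_eventuallyEq (h.frame.mono fun u hu => hu.orth)
  have h2 : lor (deriv (deriv X) t) (deriv X t) + lor (deriv X t) (deriv (deriv X) t) = 0 := by
    refine (h.hasDerivAt_deriv.lor h.hasDerivAt_deriv).unique ?_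
    exact (hasDerivAt_const t (-1 : ℝ)).congr_of_eventuallyEq (h.frame.mono fun u hu => hu.unit)
  have := hF.eq_add_smul_normal (Q := deriv (deriv X) t)
    (by rw [lor_comm]; linarith [hF.unit]) (by rw [lor_comm (deriv X t)] at h2; linarith)
  rw [geodesicCurvature, neg_smul, ← sub_eq_add_neg]
  exact this

end Curve

section Variation

variable {X T Y S : ℝ × ℝ × ℝ} {l c s c' s' : ℝ}

theorem IsChord.sinhDist_eq (h : IsChord X T Y S l c s c' s') (hX : IsFrame X T) :
    sinhDist X Y = Real.sinh l := _root_.sinhDist_eq h.pos (h.lor_points hX)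

theorem IsChord.lor_source_tangent (h : IsChord X T Y S l c s c' s') (hY : IsFrame Y S) :
    lor X S = Real.sinh l * c' := by
  rw [lor_comm, h.symm.lor_tangent_target hY]; ring

/-- Variation of the angle at the source of a chord when its target moves along a curve. -/
theorem IsChord.hasDerivAt_cos {Y : ℝ → ℝ × ℝ × ℝ} {t : ℝ} (hYt : IsUnitCurveAt Y t)
    (h : IsChord X T (Y t) (deriv Y t) l c s c' s') (hX : IsFrame X T) :
    HasDerivAt (fun u => lor T (Y u) / sinhDist X (Y u)) (s * s' / Real.sinh l) t := by
  have hs := Real.sinh_pos_iff.2 h.pos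
  have hY := hYt.frame.self_of_nhds
  have h1 := (hasDerivAt_const t X).lor hYt.hasDerivAt
  have h2 := (hasDerivAt_const t T).lor hYt.hasDerivAt
  have h3 := h1.sinhDist h.pos (h.lor_points hX)
  have hd := h.sinhDist_eq hX
  refine (h2.fun_div h3 (by rw [hd]; exact hs.ne')).congr_deriv ?_
  have e0 : lor 0 (Y t) = 0 := by simp [lor]
  rw [hd, e0, h.lor_tangents hX hY, h.lor_source_tangent hY, h.lor_tangent_target hX]
  field_simp
  ring

/-- The quotient is minus the sine of the angle at the source; that angle turns at rate `s' / sinh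
l` as the target moves. -/
theorem IsChord.hasDerivAt_sin {Y : ℝ → ℝ × ℝ × ℝ} {t : ℝ} (hYt : IsUnitCurveAt Y t)
    (h : IsChord X T (Y t) (deriv Y t) l c s c' s') (hX : IsFrame X T) :
    HasDerivAt (fun u => lor (lcross X T) (Y u) / sinhDist X (Y u))
      (-(c * s') / Real.sinh l) t := by
  have hs := Real.sinh_pos_iff.2 h.pos
  have hY := hYt.frame.self_of_nhds
  have h1 := (hasDerivAt_const t X).lor hYt.hasDerivAt
  have h2 := (hasDerivAt_const t (lcross X T)).lor hYt.hasDerivAt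
  have h3 := h1.sinhDist h.pos (h.lor_points hX)
  have hd := h.sinhDist_eq hX
  refine (h2.fun_div h3 (by rw [hd]; exact hs.ne')).congr_deriv ?_
  have e0 : lor 0 (Y t) = 0 := by simp [lor]
  rw [hd, e0, h.lor_normal_tangent hX hY, h.lor_source_tangent hY, h.lor_normal_target hX]
  field_simp
  ring

/-- Variation of the distance along a chord when its target moves along a curve. -/
theorem IsChord.hasDerivAt_cosh {Y : ℝ → ℝ × ℝ × ℝ} {t : ℝ} (hYt : IsUnitCurveAt Y t)
    (h : IsChord X T (Y t) (deriv Y t) l c s c' s') :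
    HasDerivAt (fun u => lor X (Y u)) (Real.sinh l * c') t := by
  convert (hasDerivAt_const t X).lor hYt.hasDerivAt using 1
  have e0 : lor 0 (Y t) = 0 := by simp [lor]
  rw [h.lor_source_tangent hYt.frame.self_of_nhds, e0, zero_add]

theorem IsChord.hasDerivAt_sinh {Y : ℝ → ℝ × ℝ × ℝ} {t : ℝ} (hYt : IsUnitCurveAt Y t)
    (h : IsChord X T (Y t) (deriv Y t) l c s c' s') (hX : IsFrame X T) :
    HasDerivAt (fun u => sinhDist X (Y u)) (Real.cosh l * c') t := by
  have hs := Real.sinh_pos_iff.2 h.pos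
  convert HasDerivAt.sinhDist (f := fun _ => X) h.pos (h.lor_points hX)
    (h.hasDerivAt_cosh hYt) using 1
  field_simp

/-- Variation of the angle at the source of a chord when the source moves along a curve. -/
theorem IsChord.hasDerivAt_source {X : ℝ → ℝ × ℝ × ℝ} {t : ℝ} (hXt : IsUnitCurveAt X t)
    (h : IsChord (X t) (deriv X t) Y S l c s c' s') :
    HasDerivAt (fun u => lor (deriv X u) Y / sinhDist (X u) Y)
      (s ^ 2 * Real.cosh l / Real.sinh l - geodesicCurvature X t * s) t := by
  have hs := Real.sinh_pos_iff.2 h.pos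
  have hX := hXt.frame.self_of_nhds
  have h1 := hXt.hasDerivAt.lor (hasDerivAt_const t Y)
  have h2 := hXt.hasDerivAt_deriv.lor (hasDerivAt_const t Y)
  have h3 := h1.sinhDist h.pos (h.lor_points hX)
  have hd := h.sinhDist_eq hX
  refine (h2.fun_div h3 (by rw [hd]; exact hs.ne')).congr_deriv ?_
  have e0 : ∀ P, lor P 0 = 0 := fun P => by simp [lor]
  rw [hd, e0, e0, hXt.frenet, lor_add_left, lor_smul_left, h.lor_points hX,
    h.lor_normal_target hX, h.lor_tangent_target hX]
  field_simp
  linear_combination -(Real.sinh l * Real.cosh l) * h.circle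

end Variation

/-! ### The Hessian of the perimeter and its degeneration. -/

section Orbits

variable (X₁ X₂ X₃ : ℝ → ℝ × ℝ × ℝ)

/-- The derivative of the perimeter of a triangle with vertices on three curves, with respect to
the first vertex. -/
def perimeterDeriv (p : ℝ × ℝ × ℝ) : ℝ :=
  lor (deriv X₁ p.1) (X₂ p.2.1) / sinhDist (X₁ p.1) (X₂ p.2.1) +
    lor (deriv X₁ p.1) (X₃ p.2.2) / sinhDist (X₁ p.1) (X₃ p.2.2)

/-- The quotient `(sinh (a + d) - sinh b) / (sinh a * sinh d)` for the side lengths of a triangle,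
`b` being opposite to the first vertex. -/
def sideRatio (p : ℝ × ℝ × ℝ) : ℝ :=
  (sinhDist (X₁ p.1) (X₂ p.2.1) * lor (X₁ p.1) (X₃ p.2.2) +
    lor (X₁ p.1) (X₂ p.2.1) * sinhDist (X₁ p.1) (X₃ p.2.2) -
    sinhDist (X₂ p.2.1) (X₃ p.2.2)) /
  (sinhDist (X₁ p.1) (X₂ p.2.1) * sinhDist (X₁ p.1) (X₃ p.2.2))

/-- The deviation of the curvature at the first vertex from the value that it must have at the
vertex of a triangle where the Hessian of the perimeter has rank one. -/
def curvatureDefect (p : ℝ × ℝ × ℝ) : ℝ :=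
  2 * geodesicCurvature X₁ p.1 +
    lor (lcross (X₁ p.1) (deriv X₁ p.1)) (X₂ p.2.1) / sinhDist (X₁ p.1) (X₂ p.2.1) *
      sideRatio X₁ X₂ X₃ p

variable {X₁ X₂ X₃} {p : ℝ × ℝ × ℝ} {a b d c₁ s₁ c₂ s₂ c₃ s₃ : ℝ}

variable (X₁ X₂ X₃ p a b d c₁ s₁ c₂ s₂ c₃ s₃) in
/-- A billiard triangle with vertices on three curves. -/
structure IsOrbitAt : Prop where
  curve₁ : IsUnitCurveAt X₁ p.1
  curve₂ : IsUnitCurveAt X₂ p.2.1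
  curve₃ : IsUnitCurveAt X₃ p.2.2
  orbit : IsOrbit (X₁ p.1) (deriv X₁ p.1) (X₂ p.2.1) (deriv X₂ p.2.1) (X₃ p.2.2) (deriv X₃ p.2.2)
    a b d c₁ s₁ c₂ s₂ c₃ s₃

variable (X₁ X₂ X₃) in
/-- The parameters of the billiard triangles with vertices on three curves and without grazing
vertices. -/
def orbitSet : Set (ℝ × ℝ × ℝ) :=
  {p | ∃ a b d c₁ s₁ c₂ s₂ c₃ s₃ : ℝ, 0 < s₁ ∧ 0 < s₂ ∧ 0 < s₃ ∧
    IsOrbitAt X₁ X₂ X₃ p a b d c₁ s₁ c₂ s₂ c₃ s₃}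

theorem IsUnitCurveAt.contDiffAt_first (h : IsUnitCurveAt X₁ p.1) :
    ContDiffAt ℝ 1 (fun q : ℝ × ℝ × ℝ => X₁ q.1) p :=
  ContDiffAt.comp p (h.smooth.of_le (by simp)) contDiffAt_fst

theorem IsUnitCurveAt.contDiffAt_second (h : IsUnitCurveAt X₂ p.2.1) :
    ContDiffAt ℝ 1 (fun q : ℝ × ℝ × ℝ => X₂ q.2.1) p :=
  ContDiffAt.comp (f := fun q : ℝ × ℝ × ℝ => q.2.1) p (h.smooth.of_le (by simp)) (by fun_prop)

theorem IsUnitCurveAt.contDiffAt_third (h : IsUnitCurveAt X₃ p.2.2) :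
    ContDiffAt ℝ 1 (fun q : ℝ × ℝ × ℝ => X₃ q.2.2) p :=
  ContDiffAt.comp (f := fun q : ℝ × ℝ × ℝ => q.2.2) p (h.smooth.of_le (by simp)) (by fun_prop)

theorem IsUnitCurveAt.contDiffAt_deriv_first (h : IsUnitCurveAt X₁ p.1) :
    ContDiffAt ℝ 1 (fun q : ℝ × ℝ × ℝ => deriv X₁ q.1) p :=
  ContDiffAt.comp p (h.smooth.deriv_of_top.of_le (by simp)) contDiffAt_fst

theorem IsUnitCurveAt.contDiffAt_deriv_second (h : IsUnitCurveAt X₂ p.2.1) :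
    ContDiffAt ℝ 1 (fun q : ℝ × ℝ × ℝ => deriv X₂ q.2.1) p :=
  ContDiffAt.comp (f := fun q : ℝ × ℝ × ℝ => q.2.1) p (h.smooth.deriv_of_top.of_le (by simp))
    (by fun_prop)

theorem IsUnitCurveAt.contDiffAt_curvature_first (h : IsUnitCurveAt X₁ p.1) :
    ContDiffAt ℝ 1 (fun q : ℝ × ℝ × ℝ => geodesicCurvature X₁ q.1) p := by
  have h1 : ContDiffAt ℝ 1 (geodesicCurvature X₁) p.1 :=
    ((h.smooth.deriv_of_top.deriv_of_top.lor (h.smooth.lcross h.smooth.deriv_of_top)).neg).of_le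
      (by simp)
  exact ContDiffAt.comp (f := fun q : ℝ × ℝ × ℝ => q.1) (g := geodesicCurvature X₁) p h1
    contDiffAt_fst

namespace IsOrbitAt

theorem lor₁₂ (h : IsOrbitAt X₁ X₂ X₃ p a b d c₁ s₁ c₂ s₂ c₃ s₃) :
    lor (X₁ p.1) (X₂ p.2.1) = Real.cosh a := h.orbit.chord₁.lor_points h.orbit.frame₁
theorem lor₂₃ (h : IsOrbitAt X₁ X₂ X₃ p a b d c₁ s₁ c₂ s₂ c₃ s₃) :
    lor (X₂ p.2.1) (X₃ p.2.2) = Real.cosh b := h.orbit.chord₂.lor_points h.orbit.frame₂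
theorem lor₁₃ (h : IsOrbitAt X₁ X₂ X₃ p a b d c₁ s₁ c₂ s₂ c₃ s₃) :
    lor (X₁ p.1) (X₃ p.2.2) = Real.cosh d := by
  rw [lor_comm]; exact h.orbit.chord₃.lor_points h.orbit.frame₃
theorem sinhDist₁₂ (h : IsOrbitAt X₁ X₂ X₃ p a b d c₁ s₁ c₂ s₂ c₃ s₃) :
    sinhDist (X₁ p.1) (X₂ p.2.1) = Real.sinh a :=
  sinhDist_eq h.orbit.chord₁.pos h.lor₁₂
theorem sinhDist₂₃ (h : IsOrbitAt X₁ X₂ X₃ p a b d c₁ s₁ c₂ s₂ c₃ s₃) :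
    sinhDist (X₂ p.2.1) (X₃ p.2.2) = Real.sinh b :=
  sinhDist_eq h.orbit.chord₂.pos h.lor₂₃
theorem sinhDist₁₃ (h : IsOrbitAt X₁ X₂ X₃ p a b d c₁ s₁ c₂ s₂ c₃ s₃) :
    sinhDist (X₁ p.1) (X₃ p.2.2) = Real.sinh d :=
  sinhDist_eq h.orbit.chord₃.pos h.lor₁₃
theorem sinh₁₂_pos (h : IsOrbitAt X₁ X₂ X₃ p a b d c₁ s₁ c₂ s₂ c₃ s₃) :
    0 < Real.sinh a := Real.sinh_pos_iff.2 h.orbit.chord₁.pos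
theorem sinh₂₃_pos (h : IsOrbitAt X₁ X₂ X₃ p a b d c₁ s₁ c₂ s₂ c₃ s₃) :
    0 < Real.sinh b := Real.sinh_pos_iff.2 h.orbit.chord₂.pos
theorem sinh₁₃_pos (h : IsOrbitAt X₁ X₂ X₃ p a b d c₁ s₁ c₂ s₂ c₃ s₃) :
    0 < Real.sinh d := Real.sinh_pos_iff.2 h.orbit.chord₃.pos

theorem contDiffAt_sinhDist₁₂ (h : IsOrbitAt X₁ X₂ X₃ p a b d c₁ s₁ c₂ s₂ c₃ s₃) :
    ContDiffAt ℝ 1 (fun q : ℝ × ℝ × ℝ => sinhDist (X₁ q.1) (X₂ q.2.1)) p :=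
  ContDiffAt.sinhDist h.orbit.chord₁.pos h.lor₁₂ h.curve₁.contDiffAt_first
    h.curve₂.contDiffAt_second

theorem contDiffAt_sinhDist₁₃ (h : IsOrbitAt X₁ X₂ X₃ p a b d c₁ s₁ c₂ s₂ c₃ s₃) :
    ContDiffAt ℝ 1 (fun q : ℝ × ℝ × ℝ => sinhDist (X₁ q.1) (X₃ q.2.2)) p :=
  ContDiffAt.sinhDist h.orbit.chord₃.pos h.lor₁₃ h.curve₁.contDiffAt_first
    h.curve₃.contDiffAt_third

theorem contDiffAt_sinhDist₂₃ (h : IsOrbitAt X₁ X₂ X₃ p a b d c₁ s₁ c₂ s₂ c₃ s₃) :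
    ContDiffAt ℝ 1 (fun q : ℝ × ℝ × ℝ => sinhDist (X₂ q.2.1) (X₃ q.2.2)) p :=
  ContDiffAt.sinhDist h.orbit.chord₂.pos h.lor₂₃ h.curve₂.contDiffAt_second
    h.curve₃.contDiffAt_third

theorem contDiffAt_perimeterDeriv (h : IsOrbitAt X₁ X₂ X₃ p a b d c₁ s₁ c₂ s₂ c₃ s₃) :
    ContDiffAt ℝ 1 (perimeterDeriv X₁ X₂ X₃) p := by
  refine ContDiffAt.add (ContDiffAt.div ?_ h.contDiffAt_sinhDist₁₂ ?_)
    (ContDiffAt.div ?_ h.contDiffAt_sinhDist₁₃ ?_)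
  · exact h.curve₁.contDiffAt_deriv_first.lor h.curve₂.contDiffAt_second
  · rw [h.sinhDist₁₂]; exact h.sinh₁₂_pos.ne'
  · exact h.curve₁.contDiffAt_deriv_first.lor h.curve₃.contDiffAt_third
  · rw [h.sinhDist₁₃]; exact h.sinh₁₃_pos.ne'

/-- Exchanging the roles of the first two curves in `perimeterDeriv` gives the derivative of the
perimeter in the second vertex. -/
theorem contDiffAt_perimeterDeriv_second (h : IsOrbitAt X₁ X₂ X₃ p a b d c₁ s₁ c₂ s₂ c₃ s₃) :
    ContDiffAt ℝ 1 (fun q : ℝ × ℝ × ℝ => perimeterDeriv X₂ X₁ X₃ (q.2.1, q.1, q.2.2)) p := by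
  have h12 : ContDiffAt ℝ 1 (fun q : ℝ × ℝ × ℝ => sinhDist (X₂ q.2.1) (X₁ q.1)) p := by
    simpa only [sinhDist_comm] using h.contDiffAt_sinhDist₁₂
  refine ContDiffAt.add (ContDiffAt.div ?_ h12 ?_)
    (ContDiffAt.div ?_ h.contDiffAt_sinhDist₂₃ ?_)
  · exact h.curve₂.contDiffAt_deriv_second.lor h.curve₁.contDiffAt_first
  · rw [sinhDist_comm, h.sinhDist₁₂]; exact h.sinh₁₂_pos.ne'
  · exact h.curve₂.contDiffAt_deriv_second.lor h.curve₃.contDiffAt_third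
  · rw [h.sinhDist₂₃]; exact h.sinh₂₃_pos.ne'

theorem contDiffAt_curvatureDefect (h : IsOrbitAt X₁ X₂ X₃ p a b d c₁ s₁ c₂ s₂ c₃ s₃) :
    ContDiffAt ℝ 1 (curvatureDefect X₁ X₂ X₃) p := by
  refine ContDiffAt.add (contDiffAt_const.mul h.curve₁.contDiffAt_curvature_first)
    (ContDiffAt.mul (ContDiffAt.div ?_ h.contDiffAt_sinhDist₁₂ ?_) (ContDiffAt.div (ContDiffAt.sub
      (ContDiffAt.add (h.contDiffAt_sinhDist₁₂.mul ?_) (ContDiffAt.mul ?_ h.contDiffAt_sinhDist₁₃))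
      h.contDiffAt_sinhDist₂₃) (h.contDiffAt_sinhDist₁₂.mul h.contDiffAt_sinhDist₁₃) ?_))
  · exact (h.curve₁.contDiffAt_first.lcross h.curve₁.contDiffAt_deriv_first).lor
      h.curve₂.contDiffAt_second
  · rw [h.sinhDist₁₂]; exact h.sinh₁₂_pos.ne'
  · exact h.curve₁.contDiffAt_first.lor h.curve₃.contDiffAt_third
  · exact h.curve₁.contDiffAt_first.lor h.curve₂.contDiffAt_second
  · rw [h.sinhDist₁₂, h.sinhDist₁₃]; exact (mul_pos h.sinh₁₂_pos h.sinh₁₃_pos).ne'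

theorem perimeterDeriv_eq_zero (h : IsOrbitAt X₁ X₂ X₃ p a b d c₁ s₁ c₂ s₂ c₃ s₃) :
    perimeterDeriv X₁ X₂ X₃ p = 0 := by
  have := h.sinh₁₂_pos
  have := h.sinh₁₃_pos
  rw [perimeterDeriv, h.sinhDist₁₂, h.sinhDist₁₃,
    h.orbit.chord₁.lor_tangent_target h.orbit.frame₁,
    h.orbit.chord₃.symm.lor_tangent_target h.orbit.frame₁]
  field_simp
  ring

theorem perimeterDeriv_second_eq_zero (h : IsOrbitAt X₁ X₂ X₃ p a b d c₁ s₁ c₂ s₂ c₃ s₃) :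
    perimeterDeriv X₂ X₁ X₃ (p.2.1, p.1, p.2.2) = 0 := by
  have := h.sinh₁₂_pos
  have := h.sinh₂₃_pos
  rw [perimeterDeriv, sinhDist_comm, h.sinhDist₁₂, h.sinhDist₂₃,
    h.orbit.chord₂.lor_tangent_target h.orbit.frame₂,
    h.orbit.chord₁.symm.lor_tangent_target h.orbit.frame₂]
  field_simp
  ring

theorem fderiv_perimeterDeriv_first (h : IsOrbitAt X₁ X₂ X₃ p a b d c₁ s₁ c₂ s₂ c₃ s₃) :
    fderiv ℝ (perimeterDeriv X₁ X₂ X₃) p (1, 0, 0) =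
    s₁ ^ 2 * (Real.cosh a / Real.sinh a + Real.cosh d / Real.sinh d) -
      2 * geodesicCurvature X₁ p.1 * s₁ := by
  refine fderiv_apply_first (h.contDiffAt_perimeterDeriv.differentiableAt one_ne_zero) ?_
  refine ((h.orbit.chord₁.hasDerivAt_source h.curve₁).add
    (h.orbit.chord₃.symm.hasDerivAt_source h.curve₁)).congr_deriv ?_
  ring

theorem fderiv_perimeterDeriv_second (h : IsOrbitAt X₁ X₂ X₃ p a b d c₁ s₁ c₂ s₂ c₃ s₃) :
    fderiv ℝ (perimeterDeriv X₁ X₂ X₃) p (0, 1, 0) =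
    s₁ * s₂ / Real.sinh a := by
  refine fderiv_apply_second (h.contDiffAt_perimeterDeriv.differentiableAt one_ne_zero) ?_
  simp only [perimeterDeriv]
  exact (h.orbit.chord₁.hasDerivAt_cos h.curve₂ h.orbit.frame₁).add_const _

theorem fderiv_perimeterDeriv_third (h : IsOrbitAt X₁ X₂ X₃ p a b d c₁ s₁ c₂ s₂ c₃ s₃) :
    fderiv ℝ (perimeterDeriv X₁ X₂ X₃) p (0, 0, 1) =
    s₁ * s₃ / Real.sinh d := by
  refine fderiv_apply_third (h.contDiffAt_perimeterDeriv.differentiableAt one_ne_zero) ?_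
  simp only [perimeterDeriv]
  exact (h.orbit.chord₃.symm.hasDerivAt_cos h.curve₃ h.orbit.frame₁).const_add _

theorem fderiv_perimeterDeriv_second_first (h : IsOrbitAt X₁ X₂ X₃ p a b d c₁ s₁ c₂ s₂ c₃ s₃) :
    fderiv ℝ (fun q : ℝ × ℝ × ℝ => perimeterDeriv X₂ X₁ X₃ (q.2.1, q.1, q.2.2)) p (1, 0, 0) =
      s₂ * s₁ / Real.sinh a := by
  refine fderiv_apply_first (h.contDiffAt_perimeterDeriv_second.differentiableAt one_ne_zero) ?_
  simp only [perimeterDeriv]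
  exact (h.orbit.chord₁.symm.hasDerivAt_cos h.curve₁ h.orbit.frame₂).add_const _

theorem fderiv_perimeterDeriv_second_third (h : IsOrbitAt X₁ X₂ X₃ p a b d c₁ s₁ c₂ s₂ c₃ s₃) :
    fderiv ℝ (fun q : ℝ × ℝ × ℝ => perimeterDeriv X₂ X₁ X₃ (q.2.1, q.1, q.2.2)) p (0, 0, 1) =
      s₂ * s₃ / Real.sinh b := by
  refine fderiv_apply_third (h.contDiffAt_perimeterDeriv_second.differentiableAt one_ne_zero) ?_
  simp only [perimeterDeriv]
  exact (h.orbit.chord₂.hasDerivAt_cos h.curve₃ h.orbit.frame₂).const_add _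

theorem sideRatio_eq (h : IsOrbitAt X₁ X₂ X₃ p a b d c₁ s₁ c₂ s₂ c₃ s₃) :
    sideRatio X₁ X₂ X₃ p =
    (Real.sinh (a + d) - Real.sinh b) / (Real.sinh a * Real.sinh d) := by
  rw [sideRatio, h.sinhDist₁₂, h.sinhDist₁₃, h.sinhDist₂₃, h.lor₁₂, h.lor₁₃, Real.sinh_add]

/-- The normalized normal pairing in the definition equals `-s₁` at a billiard triangle; it makes
the sine a function of the parameters. -/
theorem curvatureDefect_eq (h : IsOrbitAt X₁ X₂ X₃ p a b d c₁ s₁ c₂ s₂ c₃ s₃) :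
    curvatureDefect X₁ X₂ X₃ p = 2 * geodesicCurvature X₁ p.1 -
    s₁ * ((Real.sinh (a + d) - Real.sinh b) / (Real.sinh a * Real.sinh d)) := by
  have := h.sinh₁₂_pos
  rw [curvatureDefect, h.sideRatio_eq, h.sinhDist₁₂,
    h.orbit.chord₁.lor_normal_target h.orbit.frame₁]
  field_simp
  ring

/-- By the first variation, moving the second vertex changes `a` at rate `c₂` and `b` at rate `-c₂`,
with `d` fixed. -/
theorem hasDerivAt_sideRatio_second (h : IsOrbitAt X₁ X₂ X₃ p a b d c₁ s₁ c₂ s₂ c₃ s₃) :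
    HasDerivAt (fun u => sideRatio X₁ X₂ X₃ (p.1, u, p.2.2))
      (c₂ * (Real.sinh (a + b) - Real.sinh d) / (Real.sinh a ^ 2 * Real.sinh d)) p.2.1 := by
  have ha := h.sinh₁₂_pos
  have hd := h.sinh₁₃_pos
  have e1 := h.orbit.chord₁.hasDerivAt_sinh h.curve₂ h.orbit.frame₁
  have e2 := h.orbit.chord₁.hasDerivAt_cosh h.curve₂
  have e3 := h.orbit.chord₂.symm.hasDerivAt_sinh h.curve₂ h.orbit.frame₃
  simp only [sinhDist_comm (X₃ p.2.2)] at e3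
  refine ((((e1.mul_const (lor (X₁ p.1) (X₃ p.2.2))).add
    (e2.mul_const (sinhDist (X₁ p.1) (X₃ p.2.2)))).sub e3).fun_div
    (e1.mul_const (sinhDist (X₁ p.1) (X₃ p.2.2)))
    (by rw [h.sinhDist₁₂, h.sinhDist₁₃]; positivity)).congr_deriv ?_
  simp only [Pi.add_apply, Pi.sub_apply]
  rw [h.sinhDist₁₂, h.sinhDist₁₃, h.sinhDist₂₃, h.lor₁₂, h.lor₁₃, Real.sinh_add]
  field_simp
  linear_combination (-c₂ * Real.sinh d) * Real.cosh_sq a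

theorem hasDerivAt_sideRatio_third (h : IsOrbitAt X₁ X₂ X₃ p a b d c₁ s₁ c₂ s₂ c₃ s₃) :
    HasDerivAt (fun u => sideRatio X₁ X₂ X₃ (p.1, p.2.1, u))
      (-c₃ * (Real.sinh (b + d) - Real.sinh a) / (Real.sinh a * Real.sinh d ^ 2)) p.2.2 := by
  have ha := h.sinh₁₂_pos
  have hd := h.sinh₁₃_pos
  have e1 := h.orbit.chord₃.symm.hasDerivAt_sinh h.curve₃ h.orbit.frame₁
  have e2 := h.orbit.chord₃.symm.hasDerivAt_cosh h.curve₃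
  have e3 := h.orbit.chord₂.hasDerivAt_sinh h.curve₃ h.orbit.frame₂
  refine ((((e2.const_mul (sinhDist (X₁ p.1) (X₂ p.2.1))).add
    (e1.const_mul (lor (X₁ p.1) (X₂ p.2.1)))).sub e3).fun_div
    (e1.const_mul (sinhDist (X₁ p.1) (X₂ p.2.1)))
    (by rw [h.sinhDist₁₂, h.sinhDist₁₃]; positivity)).congr_deriv ?_
  simp only [Pi.add_apply, Pi.sub_apply]
  rw [h.sinhDist₁₂, h.sinhDist₁₃, h.sinhDist₂₃, h.lor₁₂, h.lor₁₃, Real.sinh_add]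
  field_simp
  linear_combination (c₃ * Real.sinh a) * Real.cosh_sq d

theorem fderiv_curvatureDefect_second (h : IsOrbitAt X₁ X₂ X₃ p a b d c₁ s₁ c₂ s₂ c₃ s₃) :
    fderiv ℝ (curvatureDefect X₁ X₂ X₃) p (0, 1, 0) =
      -(c₁ * s₂) / Real.sinh a *
        ((Real.sinh (a + d) - Real.sinh b) / (Real.sinh a * Real.sinh d)) -
      s₁ * (c₂ * (Real.sinh (a + b) - Real.sinh d) / (Real.sinh a ^ 2 * Real.sinh d)) := by
  have ha := h.sinh₁₂_pos
  refine fderiv_apply_second (h.contDiffAt_curvatureDefect.differentiableAt one_ne_zero) ?_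
  simp only [curvatureDefect]
  refine (((h.orbit.chord₁.hasDerivAt_sin h.curve₂ h.orbit.frame₁).fun_mul
    h.hasDerivAt_sideRatio_second).const_add _).congr_deriv ?_
  rw [show sideRatio X₁ X₂ X₃ (p.1, p.2.1, p.2.2) = _ from h.sideRatio_eq, h.sinhDist₁₂,
    h.orbit.chord₁.lor_normal_target h.orbit.frame₁]
  field_simp
  ring

theorem fderiv_curvatureDefect_third (h : IsOrbitAt X₁ X₂ X₃ p a b d c₁ s₁ c₂ s₂ c₃ s₃) :
    fderiv ℝ (curvatureDefect X₁ X₂ X₃) p (0, 0, 1) =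
      s₁ * (c₃ * (Real.sinh (b + d) - Real.sinh a) / (Real.sinh a * Real.sinh d ^ 2)) := by
  have ha := h.sinh₁₂_pos
  refine fderiv_apply_third (h.contDiffAt_curvatureDefect.differentiableAt one_ne_zero) ?_
  simp only [curvatureDefect]
  refine ((h.hasDerivAt_sideRatio_third.const_mul _).const_add _).congr_deriv ?_
  rw [h.sinhDist₁₂, h.orbit.chord₁.lor_normal_target h.orbit.frame₁]
  field_simp

/-- Along the family of triangles with fixed first vertex, the curvature at that vertex cannot stay
equal to the value prescribed by a degenerate Hessian. -/
theorem fderiv_curvatureDefect_ne_zero (h : IsOrbitAt X₁ X₂ X₃ p a b d c₁ s₁ c₂ s₂ c₃ s₃) (h₁ : 0 < s₁) (h₂ : 0 < s₂) (h₃ : 0 < s₃) :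
    fderiv ℝ (curvatureDefect X₁ X₂ X₃) p (0, Real.sinh a / s₂, -(Real.sinh d / s₃)) ≠ 0 := by
  have ha := h.sinh₁₂_pos
  have hd := h.sinh₁₃_pos
  have t₁ := Real.sinh_strictMono (h.orbit.rotate.rotate.lt_add h₁.ne')
  have t₂ := Real.sinh_strictMono (h.orbit.lt_add h₂.ne')
  have t₃ := Real.sinh_strictMono (h.orbit.rotate.lt_add h₃.ne')
  rw [add_comm d a] at t₁
  obtain ⟨h12, h13⟩ := h.orbit.cos_mul_pos h₁ h₂ h₃
  have hc₁ : 0 < c₁ ^ 2 := by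
    have : c₁ ≠ 0 := by rintro rfl; simp at h12
    positivity
  -- These speeds of the second and third vertices turn both sides at the first vertex so that the
  -- reflection law persists there to first order, its angle growing at unit rate.
  have e : ((0, Real.sinh a / s₂, -(Real.sinh d / s₃)) : ℝ × ℝ × ℝ) =
      (Real.sinh a / s₂) • (0, 1, 0) - (Real.sinh d / s₃) • (0, 0, 1) := by
    ext <;> simp
  intro h0
  rw [e, map_sub, map_smul, map_smul, h.fderiv_curvatureDefect_second,
    h.fderiv_curvatureDefect_third, smul_eq_mul, smul_eq_mul] at h0
  -- The three terms of the derivative times `-c₁`: each carries a triangle inequality and a product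
  -- of cosines of equal sign.
  have k₁ : 0 < c₁ ^ 2 * (Real.sinh (a + d) - Real.sinh b) / (Real.sinh a * Real.sinh d) := by
    have := sub_pos.2 t₁
    positivity
  have k₂ : 0 < s₁ * (c₁ * c₂) * (Real.sinh (a + b) - Real.sinh d) /
      (s₂ * Real.sinh a * Real.sinh d) := by
    have := sub_pos.2 t₂
    positivity
  have k₃ : 0 < s₁ * (c₁ * c₃) * (Real.sinh (b + d) - Real.sinh a) /
      (s₃ * Real.sinh a * Real.sinh d) := by
    have := sub_pos.2 t₃
    positivity
  have := congrArg (fun x => -c₁ * x) h0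
  simp only [mul_zero] at this
  refine (add_pos (add_pos k₁ k₂) k₃).ne' (Eq.trans ?_ this)
  field_simp
  ring

end IsOrbitAt

/-- The billiard triangles on three given curves form a set of dimension at most one. -/
theorem dimH_orbitSet_le : dimH (orbitSet X₁ X₂ X₃) ≤ 1 := by
  have hsplit : orbitSet X₁ X₂ X₃ =
      {p ∈ orbitSet X₁ X₂ X₃ | curvatureDefect X₁ X₂ X₃ p ≠ 0} ∪
      {p ∈ orbitSet X₁ X₂ X₃ | curvatureDefect X₁ X₂ X₃ p = 0} := by
    ext p; simp only [mem_union, mem_ofPred_eq]; tauto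
  rw [hsplit, dimH_union]
  refine max_le ?_ ?_
  · refine dimH_le_one_of_independent (f := perimeterDeriv X₁ X₂ X₃)
      (g := fun q : ℝ × ℝ × ℝ => perimeterDeriv X₂ X₁ X₃ (q.2.1, q.1, q.2.2)) ?_ ?_ ?_ ?_ ?_
    · rintro p ⟨⟨a, b, d, c₁, s₁, c₂, s₂, c₃, s₃, -, -, -, h⟩, -⟩
      exact h.perimeterDeriv_eq_zero
    · rintro p ⟨⟨a, b, d, c₁, s₁, c₂, s₂, c₃, s₃, -, -, -, h⟩, -⟩
      exact h.perimeterDeriv_second_eq_zero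
    · rintro p ⟨⟨a, b, d, c₁, s₁, c₂, s₂, c₃, s₃, -, -, -, h⟩, -⟩
      exact h.contDiffAt_perimeterDeriv
    · rintro p ⟨⟨a, b, d, c₁, s₁, c₂, s₂, c₃, s₃, -, -, -, h⟩, -⟩
      exact h.contDiffAt_perimeterDeriv_second
    · rintro p ⟨⟨a, b, d, c₁, s₁, c₂, s₂, c₃, s₃, h₁, h₂, h₃, h⟩, hne⟩
      -- Vanishing of this minor, divided by `s₁`, `s₂`, `s₃`, is exactly the prescribed curvature
      -- relation.
      refine ⟨(1, 0, 0), (0, 0, 1), fun heq => hne ?_⟩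
      have ha := h.sinh₁₂_pos
      have hb := h.sinh₂₃_pos
      have hd := h.sinh₁₃_pos
      rw [h.fderiv_perimeterDeriv_first, h.fderiv_perimeterDeriv_third,
        h.fderiv_perimeterDeriv_second_first, h.fderiv_perimeterDeriv_second_third] at heq
      rw [h.curvatureDefect_eq, Real.sinh_add]
      field_simp at heq ⊢
      linear_combination -heq
  · refine dimH_le_one_of_independent (f := perimeterDeriv X₁ X₂ X₃)
      (g := curvatureDefect X₁ X₂ X₃) ?_ (fun p hp => hp.2) ?_ ?_ ?_
    · rintro p ⟨⟨a, b, d, c₁, s₁, c₂, s₂, c₃, s₃, -, -, -, h⟩, -⟩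
      exact h.perimeterDeriv_eq_zero
    · rintro p ⟨⟨a, b, d, c₁, s₁, c₂, s₂, c₃, s₃, -, -, -, h⟩, -⟩
      exact h.contDiffAt_perimeterDeriv
    · rintro p ⟨⟨a, b, d, c₁, s₁, c₂, s₂, c₃, s₃, -, -, -, h⟩, -⟩
      exact h.contDiffAt_curvatureDefect
    · rintro p ⟨⟨a, b, d, c₁, s₁, c₂, s₂, c₃, s₃, h₁, h₂, h₃, h⟩, -⟩
      have ha := h.sinh₁₂_pos
      have hd := h.sinh₁₃_pos
      -- The second vector lies in the kernel of the derivative of `perimeterDeriv`, so the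
      -- determinant reduces to one product.
      refine ⟨(0, 1, 0), (0, Real.sinh a / s₂, -(Real.sinh d / s₃)), ?_⟩
      have e : ((0, Real.sinh a / s₂, -(Real.sinh d / s₃)) : ℝ × ℝ × ℝ) =
          (Real.sinh a / s₂) • (0, 1, 0) - (Real.sinh d / s₃) • (0, 0, 1) := by
        ext <;> simp
      have h0 : fderiv ℝ (perimeterDeriv X₁ X₂ X₃) p
          (0, Real.sinh a / s₂, -(Real.sinh d / s₃)) = 0 := by
        rw [e, map_sub, map_smul, map_smul, h.fderiv_perimeterDeriv_second,
          h.fderiv_perimeterDeriv_third, smul_eq_mul, smul_eq_mul]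
        field_simp
        ring
      rw [h0, zero_mul, h.fderiv_perimeterDeriv_second]
      exact mul_ne_zero (by positivity) (h.fderiv_curvatureDefect_ne_zero h₁ h₂ h₃)

end Orbits

/-! ### From the upper half-plane to the hyperboloid. -/

/-- The embedding of the upper half-plane as a sheet of the hyperboloid `lor P P = 1`. -/
def hyperboloid (z : ℂ) : ℝ × ℝ × ℝ := ((z.re ^ 2 + z.im ^ 2) / z.im, 1 / z.im, z.re / z.im)

/-- The derivative of `hyperboloid` at `z` in the direction `v`. -/
def hyperboloidDeriv (z v : ℂ) : ℝ × ℝ × ℝ :=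
  (2 * z.re * v.re / z.im + v.im - z.re ^ 2 * v.im / z.im ^ 2, -v.im / z.im ^ 2,
    v.re / z.im - z.re * v.im / z.im ^ 2)

theorem hyperboloidDeriv_add (z v w : ℂ) :
    hyperboloidDeriv z (v + w) = hyperboloidDeriv z v + hyperboloidDeriv z w := by
  ext <;> simp [hyperboloidDeriv] <;> ring

theorem hyperboloidDeriv_real_mul (z v : ℂ) (a : ℝ) :
    hyperboloidDeriv z (a * v) = a • hyperboloidDeriv z v := by
  ext <;> simp [hyperboloidDeriv] <;> ring

section

variable {z w v : ℂ}

theorem lor_hyperboloid_self (hz : z.im ≠ 0) : lor (hyperboloid z) (hyperboloid z) = 1 := by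
  simp only [lor, hyperboloid]; field_simp; ring

theorem lor_hyperboloid_hyperboloidDeriv (hz : z.im ≠ 0) :
    lor (hyperboloid z) (hyperboloidDeriv z v) = 0 := by
  simp only [lor, hyperboloid, hyperboloidDeriv]; field_simp; ring

theorem lor_hyperboloidDeriv_self (hz : z.im ≠ 0) :
    lor (hyperboloidDeriv z v) (hyperboloidDeriv z v) = -(‖v‖ ^ 2 / z.im ^ 2) := by
  rw [← Complex.normSq_eq_norm_sq, Complex.normSq_apply]
  simp only [lor, hyperboloidDeriv]; field_simp; ring

theorem isFrame_hyperboloid (hz : 0 < z.im) (hv : ‖v‖ = z.im) :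
    IsFrame (hyperboloid z) (hyperboloidDeriv z v) where
  point := lor_hyperboloid_self hz.ne'
  orth := lor_hyperboloid_hyperboloidDeriv hz.ne'
  unit := by rw [lor_hyperboloidDeriv_self hz.ne', hv]; field_simp

/-- The embedding is conformal and orientation preserving, so the cross product is multiplication by
`I`: the left normal. -/
theorem lcross_hyperboloid (hz : z.im ≠ 0) :
    lcross (hyperboloid z) (hyperboloidDeriv z v) = hyperboloidDeriv z (Complex.I * v) := by
  simp only [lcross, hyperboloid, hyperboloidDeriv, Complex.mul_re, Complex.mul_im, Complex.I_re,
    Complex.I_im]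
  ext
  · simp only; field_simp; ring
  · simp only; field_simp; ring
  · simp only; field_simp; ring

theorem hyperboloidDeriv_exp (hz : z.im ≠ 0) (θ : ℝ) :
    hyperboloidDeriv z (Complex.exp (Complex.I * θ) * v) =
      Real.cos θ • hyperboloidDeriv z v +
        Real.sin θ • lcross (hyperboloid z) (hyperboloidDeriv z v) := by
  rw [lcross_hyperboloid hz, ← hyperboloidDeriv_real_mul, ← hyperboloidDeriv_real_mul,
    ← hyperboloidDeriv_add, mul_comm Complex.I, Complex.exp_mul_I]
  congr 1
  push_cast
  ring

theorem lor_hyperboloid (z w : ℍ) :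
    lor (hyperboloid z) (hyperboloid w) = Real.cosh (dist z w) := by
  have h1 := z.im_pos
  have h2 := w.im_pos
  rw [UpperHalfPlane.cosh_dist']
  simp only [lor, hyperboloid, UpperHalfPlane.coe_re, UpperHalfPlane.coe_im]
  field_simp
  ring

theorem hyperboloid_injective : Function.Injective fun z : ℍ => hyperboloid z := by
  intro z w h
  have h0 : Real.cosh (dist z w) = 1 := by
    rw [← lor_hyperboloid, show hyperboloid z = hyperboloid w from h,
      lor_hyperboloid_self w.im_pos.ne']
  by_contra hne
  exact (Real.one_lt_cosh.2 (dist_pos.2 hne).ne').ne' h0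

theorem HasDerivAt.hyperboloid {f : ℝ → ℂ} {t : ℝ} (hf : HasDerivAt f v t) (h : (f t).im ≠ 0) :
    HasDerivAt (fun u => hyperboloid (f u)) (hyperboloidDeriv (f t) v) t := by
  have hre : HasDerivAt (fun u => (f u).re) v.re t :=
    Complex.reCLM.hasFDerivAt.comp_hasDerivAt t hf
  have him : HasDerivAt (fun u => (f u).im) v.im t :=
    Complex.imCLM.hasFDerivAt.comp_hasDerivAt t hf
  have h1 := ((hre.fun_pow 2).fun_add (him.fun_pow 2)).fun_div him h
  have h2 := (hasDerivAt_const t (1 : ℝ)).fun_div him h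
  have h3 := hre.fun_div him h
  refine (h1.prodMk (h2.prodMk h3)).congr_deriv ?_
  ext
  · simp only [hyperboloidDeriv]; push_cast; field_simp; ring
  · simp only [hyperboloidDeriv]; field_simp; ring
  · simp only [hyperboloidDeriv]; field_simp

theorem ContDiffAt.hyperboloid {f : ℝ → ℂ} {t : ℝ} {n : WithTop ℕ∞} (hf : ContDiffAt ℝ n f t)
    (h : (f t).im ≠ 0) : ContDiffAt ℝ n (fun u => hyperboloid (f u)) t := by
  have hre : ContDiffAt ℝ n (fun u => (f u).re) t :=
    Complex.reCLM.contDiff.contDiffAt.comp t hf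
  have him : ContDiffAt ℝ n (fun u => (f u).im) t :=
    Complex.imCLM.contDiff.contDiffAt.comp t hf
  exact (((hre.pow 2).add (him.pow 2)).div him h).prodMk
    ((contDiffAt_const.div him h).prodMk (hre.div him h))

end

/-- A unit speed geodesic is determined by its velocity at one time. -/
theorem hyperboloid_geodesic {γ : ℝ → ℍ} (hγ : Isometry γ) {t₀ : ℝ} {v : ℂ}
    (hv : HasDerivAt (fun t => (γ t : ℂ)) v t₀) (hn : ‖v‖ = (γ t₀).im) (l : ℝ) :
    hyperboloid (γ (t₀ + l)) = Real.cosh l • hyperboloid (γ t₀) +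
      Real.sinh l • hyperboloidDeriv (γ t₀) v := by
  have hF : IsFrame (hyperboloid (γ t₀)) (hyperboloidDeriv (γ t₀) v) :=
    isFrame_hyperboloid (γ t₀).im_pos hn
  have hd : ∀ t, lor (hyperboloid (γ t)) (hyperboloid (γ (t₀ + l))) =
      Real.cosh (t - (t₀ + l)) := fun t => by
    rw [lor_hyperboloid, hγ.dist_eq, Real.dist_eq, Real.cosh_abs]
  have h1 : lor (hyperboloid (γ t₀)) (hyperboloid (γ (t₀ + l))) = Real.cosh l := by
    rw [hd, ← Real.cosh_neg]; ring_nf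
  -- Differentiate cosh of the distance from `γ t` to the fixed point `γ (t₀ + l)` at `t = t₀`.
  have h2 : lor (hyperboloidDeriv (γ t₀) v) (hyperboloid (γ (t₀ + l))) = -Real.sinh l := by
    have e1 := (hv.hyperboloid (γ t₀).im_pos.ne').lor
      (hasDerivAt_const t₀ (hyperboloid (γ (t₀ + l))))
    have e2 := ((hasDerivAt_id t₀).sub_const (t₀ + l)).cosh
    have e3 := e1.unique (e2.congr_of_eventuallyEq (Eventually.of_forall hd))
    have e0 : ∀ P, lor P 0 = 0 := fun P => by simp [lor]
    rw [e0, add_zero] at e3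
    rw [e3, ← Real.sinh_neg]
    simp
  have h3 : lor (hyperboloid (γ (t₀ + l))) (hyperboloid (γ (t₀ + l))) = 1 :=
    lor_hyperboloid_self (γ _).im_pos.ne'
  rw [← sub_eq_zero]
  generalize hyperboloid (γ (t₀ + l)) = Q at *
  generalize hyperboloid (γ t₀) = P at *
  generalize hyperboloidDeriv (γ t₀) v = E at *
  -- The difference of the two sides is null and orthogonal to the timelike `P`, so the known
  -- pairings suffice.
  refine eq_zero_of_lor_eq_zero hF.point ?_ ?_
  · simp only [lor_sub_left, lor_sub_right, lor_add_left, lor_add_right, lor_smul_left,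
      lor_smul_right, lor_comm Q P, lor_comm Q E, lor_comm E P, h1, h2, h3, hF.point, hF.orth,
      hF.unit]
    linear_combination - Real.cosh_sq l
  · simp only [lor_sub_left, lor_add_left, lor_smul_left, lor_comm Q P, lor_comm E P, h1,
      hF.point, hF.orth]
    ring

/-! ### Billiard steps as chords; absence of grazing. -/

namespace HyperbolicBilliard

variable {B : HyperbolicBilliard}

/-- A boundary arc as a curve on the hyperboloid. -/
def arcCurve (B : HyperbolicBilliard) (i : B.ι) (s : ℝ) : ℝ × ℝ × ℝ := hyperboloid (B.arc i s)

theorem hasDerivAt_arc {i : B.ι} {s : ℝ} (hs : s ∈ Ioo 0 (B.len i)) :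
    HasDerivAt (fun u => (B.arc i u : ℂ))
      (derivWithin (fun u => (B.arc i u : ℂ)) (Icc 0 (B.len i)) s) s :=
  (((B.smooth i).differentiableOn (by simp)) s (Ioo_subset_Icc_self hs)).hasDerivWithinAt.hasDerivAt
    (Icc_mem_nhds hs.1 hs.2)

theorem deriv_arcCurve {i : B.ι} {s : ℝ} (hs : s ∈ Ioo 0 (B.len i)) :
    deriv (B.arcCurve i) s = hyperboloidDeriv (B.arc i s)
      (derivWithin (fun u => (B.arc i u : ℂ)) (Icc 0 (B.len i)) s) :=
  ((hasDerivAt_arc hs).hyperboloid (B.arc i s).im_pos.ne').deriv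

theorem isUnitCurveAt_arcCurve {i : B.ι} {s : ℝ} (hs : s ∈ Ioo 0 (B.len i)) :
    IsUnitCurveAt (B.arcCurve i) s where
  smooth := (((B.smooth i) s (Ioo_subset_Icc_self hs)).contDiffAt
    (Icc_mem_nhds hs.1 hs.2)).hyperboloid (B.arc i s).im_pos.ne'
  frame := by
    filter_upwards [Ioo_mem_nhds hs.1 hs.2] with u hu
    rw [deriv_arcCurve hu]
    exact isFrame_hyperboloid (B.arc i u).im_pos (B.unit_speed i u (Ioo_subset_Icc_self hu))

theorem HasTangent.exists_arc {p : ℍ} {τ : ℂ} (h : B.HasTangent p τ) :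
    ∃ i, ∃ s ∈ Icc 0 (B.len i), B.arc i s = p ∧
      τ = derivWithin (fun u => (B.arc i u : ℂ)) (Icc 0 (B.len i)) s := by
  have : τ ∈ B.tangents p := by rw [h]; rfl
  exact this

theorem HasTangent.eq_derivWithin {i : B.ι} {s : ℝ} {τ : ℂ} (h : B.HasTangent (B.arc i s) τ)
    (hs : s ∈ Icc 0 (B.len i)) :
    derivWithin (fun u => (B.arc i u : ℂ)) (Icc 0 (B.len i)) s = τ := by
  have : derivWithin (fun u => (B.arc i u : ℂ)) (Icc 0 (B.len i)) s ∈ B.tangents (B.arc i s) :=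
    ⟨i, s, hs, rfl, rfl⟩
  rw [h] at this
  exact this

theorem HasTangent.eq {p : ℍ} {τ σ : ℂ} (h : B.HasTangent p τ) (h' : B.HasTangent p σ) :
    τ = σ := by
  rw [HasTangent] at h h'
  exact singleton_injective (h.symm.trans h')

theorem HasTangent.norm_eq {p : ℍ} {τ : ℂ} (h : B.HasTangent p τ) : ‖τ‖ = p.im := by
  obtain ⟨i, s, hs, rfl, rfl⟩ := h.exists_arc
  exact B.unit_speed i s hs

theorem HasTangent.notMem_domain {p : ℍ} {τ : ℂ} (h : B.HasTangent p τ) : p ∉ B.domain := by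
  obtain ⟨i, s, hs, rfl, rfl⟩ := h.exists_arc
  have : B.arc i s ∈ frontier B.domain := by
    rw [B.frontier_eq]
    exact mem_iUnion.2 ⟨i, mem_image_of_mem _ hs⟩
  rw [B.isOpen_domain.frontier_eq] at this
  exact this.2

theorem HasTangent.isFrame {p : ℍ} {τ : ℂ} (h : B.HasTangent p τ) :
    IsFrame (hyperboloid p) (hyperboloidDeriv p τ) :=
  isFrame_hyperboloid p.im_pos h.norm_eq

/-- A step of the billiard ball map runs along a chord through the domain. -/
theorem Step.exists_chord {x y : ℍ × ℝ} (h : B.Step x y) {τ σ : ℂ} (hτ : B.HasTangent x.1 τ)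
    (hσ : B.HasTangent y.1 σ) :
    ∃ l, IsChord (hyperboloid x.1) (hyperboloidDeriv x.1 τ) (hyperboloid y.1)
        (hyperboloidDeriv y.1 σ) l (Real.cos x.2) (Real.sin x.2) (Real.cos y.2) (Real.sin y.2) ∧
      ∀ t ∈ Ioo 0 l, ∃ w ∈ B.domain, hyperboloid w = Real.cosh t • hyperboloid x.1 +
        Real.sinh t • (Real.cos x.2 • hyperboloidDeriv x.1 τ +
          Real.sin x.2 • lcross (hyperboloid x.1) (hyperboloidDeriv x.1 τ)) := by
  obtain ⟨-, -, τ', σ', hτ', hσ', γ, l, hγ, hl, h0, h1, hd0, hd1, hdom⟩ := h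
  obtain rfl := hτ.eq hτ'
  obtain rfl := hσ.eq hσ'
  have n0 : ‖Complex.exp (Complex.I * x.2) * τ‖ = (γ 0).im := by
    rw [norm_mul, mul_comm Complex.I, Complex.norm_exp_ofReal_mul_I, one_mul, hτ.norm_eq, h0]
  have e1 : Complex.exp (-(Complex.I * y.2)) = Complex.exp (Complex.I * (-y.2 : ℝ)) := by
    push_cast; ring_nf
  rw [e1] at hd1
  have n1 : ‖Complex.exp (Complex.I * (-y.2 : ℝ)) * σ‖ = (γ l).im := by
    rw [norm_mul, mul_comm Complex.I, Complex.norm_exp_ofReal_mul_I, one_mul, hσ.norm_eq, h1]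
  have g0 := hyperboloid_geodesic hγ hd0 n0
  -- The geodesic read backwards from its arrival point gives the `source` equation.
  have g1 := hyperboloid_geodesic hγ hd1 n1 (-l)
  simp only [zero_add, h0, hyperboloidDeriv_exp x.1.im_pos.ne'] at g0
  rw [add_neg_cancel, h0, h1, hyperboloidDeriv_exp y.1.im_pos.ne', Real.cosh_neg,
    Real.sinh_neg, Real.cos_neg, Real.sin_neg] at g1
  refine ⟨l, ⟨hl, Real.cos_sq_add_sin_sq _, Real.cos_sq_add_sin_sq _, ?_, ?_⟩, fun t ht =>
    ⟨γ t, hdom t ht, g0 t⟩⟩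
  · rw [← g0, h1]
  · rw [g1]; module

/-- Three consecutive steps of a 3-periodic point form a billiard triangle, whose last side runs
through the domain. -/
theorem exists_isOrbit {x y z : ℍ × ℝ} (hxy : B.Step x y) (hyz : B.Step y z) (hzx : B.Step z x)
    {τ σ ρ : ℂ} (hτ : B.HasTangent x.1 τ) (hσ : B.HasTangent y.1 σ) (hρ : B.HasTangent z.1 ρ) :
    ∃ a b d, IsOrbit (hyperboloid x.1) (hyperboloidDeriv x.1 τ)
        (hyperboloid y.1) (hyperboloidDeriv y.1 σ) (hyperboloid z.1) (hyperboloidDeriv z.1 ρ)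
        a b d (Real.cos x.2) (Real.sin x.2) (Real.cos y.2) (Real.sin y.2)
        (Real.cos z.2) (Real.sin z.2) ∧
      ∀ t ∈ Ioo 0 d, ∃ w ∈ B.domain, hyperboloid w = Real.cosh t • hyperboloid z.1 +
        Real.sinh t • (Real.cos z.2 • hyperboloidDeriv z.1 ρ +
          Real.sin z.2 • lcross (hyperboloid z.1) (hyperboloidDeriv z.1 ρ)) := by
  obtain ⟨a, h1, -⟩ := hxy.exists_chord hτ hσ
  obtain ⟨b, h2, -⟩ := hyz.exists_chord hσ hρ
  obtain ⟨d, h3, h4⟩ := hzx.exists_chord hρ hτ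
  exact ⟨a, b, d, ⟨hτ.isFrame, hσ.isFrame, hρ.isFrame, h1, h2, h3⟩, h4⟩

/-- A closed billiard triangle does not graze the boundary. -/
theorem sin_pos_of_steps {x y z : ℍ × ℝ} (hxy : B.Step x y) (hyz : B.Step y z)
    (hzx : B.Step z x) : 0 < Real.sin y.2 := by
  obtain ⟨τ, σ, hτ, hσ, -⟩ := hxy.2.2
  obtain ⟨-, ρ, -, hρ, -⟩ := hyz.2.2
  obtain ⟨a, b, d, h, hdom⟩ := exists_isOrbit hxy hyz hzx hτ hσ hρ
  refine (Real.sin_nonneg_of_mem_Icc hxy.2.1).lt_of_ne fun hs => ?_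
  have hs := hs.symm
  have ha := h.chord₁.pos
  have hb := h.chord₂.pos
  have hd := h.eq_add hs
  have e₂ := h.det_eq
  have e₃ := h.rotate.det_eq
  rw [← lor_lcross_rotate, e₂, hs] at e₃
  have hb' := Real.sinh_pos_iff.2 hb
  have hd' := Real.sinh_pos_iff.2 h.chord₃.pos
  -- Grazing at `y` makes the triangle flat, so the determinant at `z` vanishes. Grazing at `z` as
  -- well would give both `d = a + b` and `a = b + d`; hence the reflection at `z` is perpendicular.
  have hcs : Real.cos z.2 * Real.sin z.2 = 0 := by
    have : 2 * (Real.sinh b * Real.sinh d) * (Real.cos z.2 * Real.sin z.2) = 0 := by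
      linear_combination e₃
    exact (mul_eq_zero.1 this).resolve_left (by positivity)
  have hz : Real.sin z.2 ≠ 0 := fun hz => by
    have := h.rotate.eq_add hz
    linarith
  have hc : Real.cos z.2 = 0 := (mul_eq_zero.1 hcs).resolve_right hz
  -- The perpendicular ray from `z` retraces the side from `y`, and since `b < d` it reaches `y`
  -- while still inside the domain.
  obtain ⟨w, hw, hwe⟩ := hdom b ⟨hb, by linarith⟩
  have : w = y.1 := by
    apply hyperboloid_injective
    simp only
    rw [hwe, h.chord₂.source, hc]
    module
  exact hσ.notMem_domain (this ▸ hw)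

end HyperbolicBilliard

/-! ### The periodic set in phase coordinates. -/

theorem IsChord.lor_div_sinhDist {X T Y S : ℝ × ℝ × ℝ} {l c s c' s' : ℝ}
    (h : IsChord X T Y S l c s c' s') (hX : IsFrame X T) : lor T Y / sinhDist X Y = -c := by
  have := Real.sinh_pos_iff.2 h.pos
  rw [h.sinhDist_eq hX, h.lor_tangent_target hX]
  field_simp

/-- The phase points on a curve whose rays or reversed rays run to a given point form a set of
dimension at most one. -/
theorem dimH_image_arccos_le {X : ℝ → ℝ × ℝ × ℝ} (Y : ℝ × ℝ × ℝ) (ε : ℝ) {Z : Set ℝ}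
    (hX : ∀ s ∈ Z, IsUnitCurveAt X s) (hl : ∀ s ∈ Z, ∃ l > 0, lor (X s) Y = Real.cosh l)
    (hc : ∀ s ∈ Z, |ε * (lor (deriv X s) Y / sinhDist (X s) Y)| < 1) :
    dimH ((fun s => (s, Real.arccos (ε * (lor (deriv X s) Y / sinhDist (X s) Y)))) '' Z) ≤ 1 := by
  refine (dimH_image_le_of_contDiffAt fun s hs => contDiffAt_id.prodMk ?_).trans
    ((dimH_mono (subset_univ Z)).trans Real.dimH_univ.le)
  obtain ⟨l, h0, hl⟩ := hl s hs
  have h1 := abs_lt.1 (hc s hs)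
  have h2 : ContDiffAt ℝ 1 X s := (hX s hs).smooth.of_le (by simp)
  have h3 : ContDiffAt ℝ 1 (deriv X) s := (hX s hs).smooth.deriv_of_top.of_le (by simp)
  have h4 : ContDiffAt ℝ 1 (fun u => ε * (lor (deriv X u) Y / sinhDist (X u) Y)) s := by
    refine contDiffAt_const.mul
      ((h3.lor contDiffAt_const).div (h2.sinhDist h0 hl contDiffAt_const) ?_)
    rw [sinhDist_eq h0 hl]
    exact (Real.sinh_pos_iff.2 h0).ne'
  exact ContDiffAt.comp (g := Real.arccos) s (Real.contDiffAt_arccos h1.1.ne' h1.2.ne) h4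

/-- The phase points of billiard triangles on three given curves form a set of dimension at most
one. -/
theorem dimH_image_orbitSet_le {X₁ X₂ X₃ : ℝ → ℝ × ℝ × ℝ} :
    dimH ((fun p : ℝ × ℝ × ℝ => (p.1, Real.arccos (-1 * (lor (deriv X₁ p.1) (X₂ p.2.1) /
      sinhDist (X₁ p.1) (X₂ p.2.1))))) '' orbitSet X₁ X₂ X₃) ≤ 1 := by
  refine (dimH_image_le_of_contDiffAt ?_).trans dimH_orbitSet_le
  rintro p ⟨a, b, d, c₁, s₁, c₂, s₂, c₃, s₃, h₁, -, -, h⟩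
  refine contDiffAt_fst.prodMk ?_
  have h0 := h.orbit.chord₁.lor_div_sinhDist h.orbit.frame₁
  have h1 : -1 < c₁ ∧ c₁ < 1 := by
    rw [← abs_lt, ← sq_lt_one_iff_abs_lt_one]
    have := h.orbit.chord₁.circle
    nlinarith
  have h4 : ContDiffAt ℝ 1 (fun q : ℝ × ℝ × ℝ => -1 * (lor (deriv X₁ q.1) (X₂ q.2.1) /
      sinhDist (X₁ q.1) (X₂ q.2.1))) p := by
    refine contDiffAt_const.mul ((h.curve₁.contDiffAt_deriv_first.lor
      h.curve₂.contDiffAt_second).div h.contDiffAt_sinhDist₁₂ ?_)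
    rw [h.sinhDist₁₂]
    exact h.sinh₁₂_pos.ne'
  refine ContDiffAt.comp (g := Real.arccos) p (Real.contDiffAt_arccos ?_ ?_) h4
  · rw [h0]; linarith
  · rw [h0]; linarith

namespace HyperbolicBilliard

variable (B : HyperbolicBilliard)

theorem countable_index : Countable B.ι :=
  countable_univ_iff.1 (B.locallyFinite_arcs.countable_univ fun i =>
    ⟨B.arc i 0, mem_image_of_mem _ ⟨le_rfl, (B.len_pos i).le⟩⟩)

/-- The ends of the boundary arcs. -/
def arcEnds : Set ℍ := ⋃ i, {B.arc i 0, B.arc i (B.len i)}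

theorem countable_arcEnds : B.arcEnds.Countable := by
  have := B.countable_index
  exact countable_iUnion fun i => (Set.toFinite _).countable

variable {B}

/-- A regular boundary point is an end of an arc, or lies inside an arc. -/
theorem HasTangent.mem_arcEnds_or {p : ℍ} {τ : ℂ} (h : B.HasTangent p τ) :
    p ∈ B.arcEnds ∨ ∃ i, ∃ s ∈ Ioo 0 (B.len i), hyperboloid p = B.arcCurve i s ∧
      hyperboloidDeriv p τ = deriv (B.arcCurve i) s := by
  obtain ⟨i, s, hs, rfl, rfl⟩ := h.exists_arc
  rcases hs.1.eq_or_lt with rfl | h0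
  · exact Or.inl (mem_iUnion.2 ⟨i, Or.inl rfl⟩)
  rcases hs.2.eq_or_lt with h1 | h1
  · exact Or.inl (mem_iUnion.2 ⟨i, Or.inr (by rw [h1]; rfl)⟩)
  · exact Or.inr ⟨i, s, ⟨h0, h1⟩, rfl, (deriv_arcCurve ⟨h0, h1⟩).symm⟩

variable (B) in
/-- The 3-periodic phase points in the interior of an arc, in the coordinates of the arc. -/
def arcPeriodic (i : B.ι) : Set (ℝ × ℝ) :=
  {q | q.1 ∈ Ioo 0 (B.len i) ∧ (B.arc i q.1, q.2) ∈ B.threePeriodic}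

variable (B) in
/-- The arclength parameters of an arc at which the point of the hyperboloid `Y` is visible at a
nonzero angle. -/
def visibleFrom (i : B.ι) (Y : ℝ × ℝ × ℝ) : Set ℝ :=
  {s | s ∈ Ioo 0 (B.len i) ∧ (∃ l > 0, lor (B.arcCurve i s) Y = Real.cosh l) ∧
    |lor (deriv (B.arcCurve i) s) Y / sinhDist (B.arcCurve i s) Y| < 1}

/-- Either all vertices are interior to arcs, or the second or third one is an arc end. The ray runs
to the second vertex and the reversed ray to the third, whence the signs `-1` and `1` of the cosine.
-/
theorem arcPeriodic_subset (i : B.ι) : B.arcPeriodic i ⊆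
    (⋃ j, ⋃ k, (fun p : ℝ × ℝ × ℝ => (p.1, Real.arccos (-1 * (lor (deriv (B.arcCurve i) p.1)
      (B.arcCurve j p.2.1) / sinhDist (B.arcCurve i p.1) (B.arcCurve j p.2.1))))) ''
        orbitSet (B.arcCurve i) (B.arcCurve j) (B.arcCurve k)) ∪
    ⋃ w ∈ B.arcEnds, ((fun s => (s, Real.arccos (-1 * (lor (deriv (B.arcCurve i) s)
      (hyperboloid w) / sinhDist (B.arcCurve i s) (hyperboloid w))))) ''
        B.visibleFrom i (hyperboloid w) ∪
      (fun s => (s, Real.arccos (1 * (lor (deriv (B.arcCurve i) s)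
      (hyperboloid w) / sinhDist (B.arcCurve i s) (hyperboloid w))))) ''
        B.visibleFrom i (hyperboloid w)) := by
  rintro ⟨s, φ⟩ ⟨hs, y, z, hxy, hyz, hzx⟩
  simp only at hs hxy hzx
  have hx := sin_pos_of_steps hzx hxy hyz
  have hy := sin_pos_of_steps hxy hyz hzx
  have hz := sin_pos_of_steps hyz hzx hxy
  obtain ⟨τ, σ, hτ, hσ, -⟩ := hxy.2.2
  obtain ⟨-, ρ, -, hρ, -⟩ := hyz.2.2
  obtain ⟨a, b, d, h, -⟩ := exists_isOrbit hxy hyz hzx hτ hσ hρ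
  have hτ' : hyperboloidDeriv (B.arc i s) τ = deriv (B.arcCurve i) s := by
    rw [deriv_arcCurve hs, hτ.eq_derivWithin (Ioo_subset_Icc_self hs)]
  simp only [hτ', show hyperboloid (B.arc i s) = B.arcCurve i s from rfl] at h
  have hφ : Real.arccos (Real.cos φ) = φ := Real.arccos_cos hxy.1.1 hxy.1.2
  have hcos : |Real.cos φ| < 1 := by
    rw [← sq_lt_one_iff_abs_lt_one]
    nlinarith [Real.cos_sq_add_sin_sq φ]
  have q₁ := h.chord₁.lor_div_sinhDist h.frame₁
  have q₃ := h.chord₃.symm.lor_div_sinhDist h.frame₁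
  rcases hσ.mem_arcEnds_or with hend | ⟨j, t, ht, hj, hj'⟩
  · refine Or.inr (mem_iUnion₂.2 ⟨y.1, hend, Or.inl ⟨s, ⟨hs, ⟨a, h.chord₁.pos,
      h.chord₁.lor_points h.frame₁⟩, ?_⟩, ?_⟩⟩)
    · rwa [q₁, abs_neg]
    · simp only [q₁, neg_mul_neg, one_mul, hφ]
  rcases hρ.mem_arcEnds_or with hend | ⟨k, u, hu, hk, hk'⟩
  · refine Or.inr (mem_iUnion₂.2 ⟨z.1, hend, Or.inr ⟨s, ⟨hs, ⟨d, h.chord₃.pos,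
      h.chord₃.symm.lor_points h.frame₁⟩, ?_⟩, ?_⟩⟩)
    · rwa [q₃, neg_neg]
    · simp only [q₃, neg_neg, one_mul, hφ]
  rw [hj, hj', hk, hk'] at h
  rw [hj] at q₁
  refine Or.inl (mem_iUnion₂.2 ⟨j, k, (s, t, u), ⟨a, b, d, _, _, _, _, _, _, hx, hy, hz,
    isUnitCurveAt_arcCurve hs, isUnitCurveAt_arcCurve ht, isUnitCurveAt_arcCurve hu, h⟩, ?_⟩)
  simp only [q₁, neg_mul_neg, one_mul, hφ]

theorem volume_arcPeriodic (i : B.ι) : volume (B.arcPeriodic i) = 0 := by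
  have := B.countable_index
  refine volume_eq_zero_of_dimH_le_one ((dimH_mono (arcPeriodic_subset i)).trans ?_)
  have hv : ∀ w : ℍ, ∀ s ∈ B.visibleFrom i (hyperboloid w), IsUnitCurveAt (B.arcCurve i) s :=
    fun w s hs => isUnitCurveAt_arcCurve hs.1
  rw [dimH_union, dimH_iUnion, dimH_bUnion B.countable_arcEnds]
  refine max_le (iSup_le fun j => ?_) (iSup₂_le fun w _ => ?_)
  · rw [dimH_iUnion]
    exact iSup_le fun k => dimH_image_orbitSet_le
  · rw [dimH_union]
    refine max_le (dimH_image_arccos_le _ _ (hv w) (fun s hs => hs.2.1) fun s hs => ?_)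
      (dimH_image_arccos_le _ _ (hv w) (fun s hs => hs.2.1) fun s hs => ?_)
    · rw [abs_mul, abs_neg, abs_one, one_mul]; exact hs.2.2
    · rw [one_mul]; exact hs.2.2

theorem injOn_arc_prod (i : B.ι) :
    InjOn (fun q : ℝ × ℝ => (B.arc i q.1, q.2)) (Ioo 0 (B.len i) ×ˢ univ) := by
  rintro ⟨s, φ⟩ ⟨hs, -⟩ ⟨t, ψ⟩ ⟨ht, -⟩ h
  simp only [Prod.mk.injEq] at h
  exact Prod.ext (B.injOn_left i (Ioo_subset_Ico_self hs) (Ioo_subset_Ico_self ht) h.1) h.2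

theorem continuousOn_arc_prod (i : B.ι) :
    ContinuousOn (fun q : ℝ × ℝ => (B.arc i q.1, q.2)) (Icc 0 (B.len i) ×ˢ univ) := by
  have h : ContinuousOn (B.arc i) (Icc 0 (B.len i)) :=
    UpperHalfPlane.isEmbedding_coe.continuousOn_iff.2 (B.smooth i).continuousOn
  exact (h.comp continuousOn_fst fun q hq => hq.1).prodMk continuousOn_snd

end HyperbolicBilliard

end

/-! ### The measure-theoretic conclusion. -/

theorem theorem1 (B : HyperbolicBilliard) : B.liouville B.threePeriodic = 0 := by
  rw [HyperbolicBilliard.liouville]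
  have := B.countable_index
  refine Measure.sum_apply_eq_zero.2 fun i => ?_
  set F : ℝ × ℝ → ℍ × ℝ := fun q => (B.arc i q.1, q.2) with hF
  set μ := ((volume : Measure (ℝ × ℝ)).restrict (Icc 0 (B.len i) ×ˢ Icc 0 Real.pi)).withDensity
      fun q => ENNReal.ofReal (Real.sin q.2) with hμ
  set A : Set (ℝ × ℝ) := Ioo 0 (B.len i) ×ˢ univ with hA
  have hAm : MeasurableSet A := measurableSet_Ioo.prod MeasurableSet.univ
  have hIm : MeasurableSet (Icc 0 (B.len i) ×ˢ Icc 0 Real.pi) :=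
    measurableSet_Icc.prod measurableSet_Icc
  have hac : μ ≪ (volume : Measure (ℝ × ℝ)).restrict (Icc 0 (B.len i) ×ˢ Icc 0 Real.pi) :=
    withDensity_absolutelyContinuous _ _
  have hFm : AEMeasurable F μ :=
    (((HyperbolicBilliard.continuousOn_arc_prod i).mono
      (prod_mono_right (subset_univ _))).aemeasurable hIm).mono_ac hac
  set N := toMeasurable volume (B.arcPeriodic i) with hN
  have hN0 : volume N = 0 := by
    rw [hN, measure_toMeasurable, HyperbolicBilliard.volume_arcPeriodic]
  have hNm : MeasurableSet N := measurableSet_toMeasurable _ _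
  -- `threePeriodic` is not known to be measurable; the complement of this injective continuous
  -- image (Lusin–Souslin) is a measurable superset.
  have himage : MeasurableSet (F '' (A \ N)) :=
    (hAm.diff hNm).image_of_continuousOn_injOn
      ((HyperbolicBilliard.continuousOn_arc_prod i).mono
        (sdiff_subset.trans (prod_mono_left Ioo_subset_Icc_self)))
      ((HyperbolicBilliard.injOn_arc_prod i).mono sdiff_subset)
  refine measure_mono_null (t := (F '' (A \ N))ᶜ) ?_ ?_
  · rintro p hp ⟨q, ⟨hqA, hqN⟩, rfl⟩
    exact hqN (subset_toMeasurable _ _ ⟨hqA.1, hp⟩)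
  · rw [Measure.map_apply_of_aemeasurable hFm himage.compl]
    refine hac ?_
    have hline : ∀ c : ℝ, volume (({c} : Set ℝ) ×ˢ (univ : Set ℝ)) = 0 := fun c => by
      rw [Measure.volume_eq_prod, Measure.prod_prod, Real.volume_singleton, zero_mul]
    -- The preimage of that superset lies outside the rectangle, in `N`, or over the two ends of the
    -- arc.
    refine measure_mono_null (t := (Icc 0 (B.len i) ×ˢ Icc 0 Real.pi)ᶜ ∪
      (N ∪ ({0} ×ˢ univ ∪ {B.len i} ×ˢ univ))) ?_ (measure_union_null ?_ ?_)
    · rintro ⟨s, φ⟩ hq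
      by_contra hcon
      simp only [mem_union, mem_compl_iff, not_or, not_not, mem_prod, mem_singleton_iff, mem_univ,
        and_true] at hcon
      obtain ⟨⟨hs, -⟩, hsN, hs0, hs1⟩ := hcon
      exact hq ⟨(s, φ), ⟨⟨⟨hs.1.lt_of_ne' hs0, hs.2.lt_of_ne hs1⟩, trivial⟩, hsN⟩, rfl⟩
    · rw [Measure.restrict_apply hIm.compl, compl_inter_self, measure_empty]
    · exact Measure.absolutelyContinuous_of_le Measure.restrict_le_self
        (measure_union_null hN0 (measure_union_null (hline _) (hline _)))
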